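/- A lattice $3$-polytope is the convex hull $P\subset\mathbb{R}^3$ of a finite subset of $\mathbb{Z}^3$ that contains four affinely independent points. Its size is $\#(P\cap\mathbb{Z}^3)$. Its width is the minimum of $\max_P f-\min_P f$ over all non-constant affine functionals $f:\mathbb{R}^3\to\mathbb{R}$ with $f(\mathbb{Z}^3)\subset\mathbb{Z}$. Two lattice $3$-polytopes $P,Q$ are unimodularly equivalent if there is an affine automorphism $t$ of $\mathbb{R}^3$ with $t(\mathbb{Z}^3)=\mathbb{Z}^3$ and $t(P)=Q$. If $P$ has size $5$, its lattice points $p_1,\dots,p_5$ have a unique (up to a nonzero scalar factor) nontrivial affine dependence $\sum_k v_kp_k=0$, $\sum_k v_k=0$; the signature of $P$ is $(i,j)$ if $i$ of the $v_k$ are positive and $j$ are negative, where $(i,j)$ and $(j,i)$ are regarded as the same signature. Theorem. Up to unimodular equivalence there are exactly nine lattice $3$-polytopes of size $5$ and width two, and there is no lattice $3$-polytope of size $5$ and width larger than two. Of the nine equivalence classes, exactly eight have signature $(4,1)$ and exactly one has signature $(3,1)$. -/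

import Mathlib

/-- The standard lattice `ℤ^d` inside `ℝ^d`. -/
def integerLattice (d : ℕ) : Set (Fin d → ℝ) :=
  Set.range fun (z : Fin d → ℤ) (i : Fin d) => (z i : ℝ)

/-- A lattice `d`-polytope: the convex hull of a finite set of points of `ℤ^d` that is
`d`-dimensional, i.e. contains `d + 1` affinely independent points. -/
structure LatticePolytope (d : ℕ) where
  /-- The underlying set of points of `ℝ^d`. -/
  carrier : Set (Fin d → ℝ)
  exists_eq_convexHull : ∃ S : Set (Fin d → ℝ),
    S.Finite ∧ S ⊆ integerLattice d ∧ carrier = convexHull ℝ S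
  full_dimensional : ∃ p : Fin (d + 1) → (Fin d → ℝ),
    AffineIndependent ℝ p ∧ ∀ i, p i ∈ carrier

namespace LatticePolytope

variable {d : ℕ}

/-- The set `P ∩ ℤ^d` of lattice points of `P`. -/
def latticePoints (P : LatticePolytope d) : Set (Fin d → ℝ) :=
  P.carrier ∩ integerLattice d

/-- The size of `P`: its number of lattice points (the set is finite as `P` is bounded). -/
noncomputable def size (P : LatticePolytope d) : ℕ :=
  P.latticePoints.ncard

/-- `f` is an affine functional with `f(ℤ^d) ⊆ ℤ`. -/
def IsIntegral (f : (Fin d → ℝ) →ᵃ[ℝ] ℝ) : Prop :=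
  ∀ x ∈ integerLattice d, ∃ n : ℤ, f x = n

/-- The width of `P` with respect to `f`, that is `max_P f - min_P f`
(`P` is compact and nonempty, so both extrema are attained). -/
noncomputable def widthWith (P : LatticePolytope d) (f : (Fin d → ℝ) →ᵃ[ℝ] ℝ) : ℝ :=
  sSup (f '' P.carrier) - sInf (f '' P.carrier)

/-- The width of `P`: the minimum of the width of `P` with respect to `f`, over all nonconstant
integral affine functionals `f`. For `d ≥ 1` this is the infimum of a nonempty set of nonnegative
integers, so it is attained. -/
noncomputable def width (P : LatticePolytope d) : ℝ :=
  sInf {w : ℝ | ∃ f : (Fin d → ℝ) →ᵃ[ℝ] ℝ,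
    IsIntegral f ∧ (¬ ∃ c : ℝ, ∀ x, f x = c) ∧ w = P.widthWith f}

/-- Unimodular equivalence: some affine automorphism of `ℝ^d` maps `ℤ^d` onto `ℤ^d` and
`P` onto `Q`. -/
def UnimodularEquiv (P Q : LatticePolytope d) : Prop :=
  ∃ t : (Fin d → ℝ) ≃ᵃ[ℝ] (Fin d → ℝ),
    t '' integerLattice d = integerLattice d ∧ t '' P.carrier = Q.carrier

theorem UnimodularEquiv.refl (P : LatticePolytope d) : UnimodularEquiv P P :=
  ⟨AffineEquiv.refl ℝ _, by simp, by simp⟩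

theorem UnimodularEquiv.symm {P Q : LatticePolytope d} (h : UnimodularEquiv P Q) :
    UnimodularEquiv Q P := by
  obtain ⟨t, h1, h2⟩ := h
  have key : ∀ A B : Set (Fin d → ℝ), t '' A = B → t.symm '' B = A := by
    rintro A B rfl
    simp [Set.image_image]
  exact ⟨t.symm, key _ _ h1, key _ _ h2⟩

theorem UnimodularEquiv.trans {P Q R : LatticePolytope d} (h : UnimodularEquiv P Q)
    (h' : UnimodularEquiv Q R) : UnimodularEquiv P R := by
  obtain ⟨t, h1, h2⟩ := h
  obtain ⟨s, h3, h4⟩ := h'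
  have key : ∀ A : Set (Fin d → ℝ), t.trans s '' A = s '' (t '' A) := by
    intro A
    simp [Set.image_image]
  exact ⟨t.trans s, by rw [key, h1, h3], by rw [key, h2, h4]⟩

/-- The setoid of unimodular equivalence on lattice `d`-polytopes. -/
def unimodularSetoid (d : ℕ) : Setoid (LatticePolytope d) where
  r := UnimodularEquiv
  iseqv := ⟨UnimodularEquiv.refl, UnimodularEquiv.symm, UnimodularEquiv.trans⟩

/-- Unimodular equivalence classes of lattice `d`-polytopes. -/
def EquivClass (d : ℕ) : Type := Quotient (unimodularSetoid d)

/-- The equivalence class of `P`. -/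
def toClass (P : LatticePolytope d) : EquivClass d := Quotient.mk (unimodularSetoid d) P

/-- `P` has exactly `d + 2` lattice points `p_1, …, p_{d+2}`, and their affine dependence
`∑ v_k p_k = 0`, `∑ v_k = 0` (nonzero; unique up to a scalar factor) has `i` positive and `j`
negative coefficients. Negating `v` shows that `(i, j)` and `(j, i)` are the same signature. -/
def HasSignature (P : LatticePolytope d) (i j : ℕ) : Prop :=
  ∃ p : Fin (d + 2) → (Fin d → ℝ), Function.Injective p ∧ Set.range p = P.latticePoints ∧
    ∃ v : Fin (d + 2) → ℝ, v ≠ 0 ∧ ∑ k, v k = 0 ∧ ∑ k, v k • p k = 0 ∧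
      {k | 0 < v k}.ncard = i ∧ {k | v k < 0}.ncard = j

end LatticePolytope

/-! White's theorem carries the proof: if the only lattice points of a lattice tetrahedron are its
vertices, then some integral functional takes one value on two vertices and the next value on the
other two. The lattice points of a polytope of size five form a `Config`, and the signs of their
affine dependence `v` show which four of them span a tetrahedron that misses the fifth. White's
theorem applies to each such tetrahedron (`exists_white`). In the coordinates 0, e₁, e₂, (a, b, h),
(c, d, -k) it yields congruences modulo the normalized volumes.

For the signatures (2,1), (2,2) and (3,2) these congruences combine into one functional of width one
for all five points. For (3,1) they bound the height of the apex over the triangle by three, and a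
single class survives besides width one. For (4,1) the volumes of the four tetrahedra around the
interior point can be ordered. The ordering and the congruences leave finitely many candidates, and
each either contains a sixth lattice point or is one of the representatives. Together this is
`IsClean.dichotomy`.

White's theorem itself is arithmetic. A lattice point at level j is excluded by an inequality
between three floors; the symmetry j ↦ h - j turns it into an equality, and comparing the jumps of
the floor sequences (`not_floor_merge`) makes one of three residues equal to 1.

Conversely, facet inequalities show that the nine representatives have no further lattice points,
integer linear arithmetic shows that they do not have width one, and their volumes are pairwise
different. -/

/-! ### Floor sums and the arithmetic of White's theorem -/

/-- Two Beatty-type sequences with slopes `b / h` and `c / h` never merge into the one with slope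
`(b + c - 1) / h` when `b, c ≥ 2`. -/
theorem not_floor_merge {h b c : ℤ} (hc : 2 ≤ c) (hcb : c ≤ b) (hm : 2 * (b + c - 1) ≤ h)
    (H : ∀ j, 0 ≤ j → j < h → j * (b + c - 1) / h = j * b / h + j * c / h) : False := by
  set m := b + c - 1 with hmdef
  have hh : 0 < h := by omega
  have hm0 : 0 < m := by omega
  -- Consecutive jumps of j ↦ ⌊j m / h⌋ are at distance `q` or `q + 1`.
  obtain ⟨q, hq⟩ : ∃ q, q = h / m := ⟨_, rfl⟩
  have hq2 : 2 ≤ q := by rw [hq, Int.le_ediv_iff_mul_le hm0]; linarith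
  have hqm : q * m ≤ h := by rw [hq]; exact Int.ediv_mul_le _ hm0.ne'
  have hqm' : h < (q + 1) * m := by
    rw [hq]; have := Int.lt_ediv_add_one_mul_self h hm0; linarith
  have h3q : 3 * q ≤ h := by nlinarith
  -- This is ⌈h / c⌉, the first jump of the sequence with slope `c / h`.
  obtain ⟨j, hj⟩ : ∃ j, j = (h + c - 1) / c := ⟨_, rfl⟩
  have hc0 : 0 < c := by omega
  have hj1 : h ≤ j * c := by
    have := Int.lt_ediv_add_one_mul_self (h + c - 1) hc0
    rw [← hj] at this; nlinarith
  have hj2 : (j - 1) * c < h := by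
    have := Int.ediv_mul_le (h + c - 1) hc0.ne'
    rw [← hj] at this; nlinarith
  have hjq : q < j := by
    by_contra hcon
    push Not at hcon
    nlinarith [mul_le_mul_of_nonneg_right hcon hc0.le]
  have hj3 : 2 * (j - 1) ≤ h - 1 := by nlinarith
  have fl : ∀ x n : ℤ, n ≤ x / h ↔ n * h ≤ x := fun x n => Int.le_ediv_iff_mul_le hh
  have fl' : ∀ x n : ℤ, x / h < n ↔ x < n * h := fun x n => Int.ediv_lt_iff_lt_mul hh
  -- The merged sequence has jumped by `q + 1`, so one of its two summands has; as `c ≤ b`, the one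
  -- of slope `b / h` has.
  have hqb : h ≤ (q + 1) * b := by
    by_contra hcon
    push Not at hcon
    have h1 := H (q + 1) (by omega) (by omega)
    have h2 : 1 ≤ (q + 1) * m / h := (fl _ _).2 (by linarith)
    have h3 : (q + 1) * b / h < 1 := (fl' _ _).2 (by linarith)
    have h4 : (q + 1) * c / h < 1 := (fl' _ _).2 (by nlinarith)
    omega
  -- The merged sequence jumps at `j`, so it grows by at most one from `j - q` to `j + q - 1`. There
  -- the `c`-sequence jumps at `j`, and the `b`-sequence also grows, because (2q - 1) b ≥ (q + 1) b
  -- ≥ h.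
  have e1 := H (j - 1) (by omega) (by omega)
  have e2 := H j (by omega) (by omega)
  have e3 := H (j + q - 1) (by omega) (by omega)
  have e4 := H (j - q) (by omega) (by omega)
  obtain ⟨N, hN⟩ : ∃ N, N = (j - 1) * m / h := ⟨_, rfl⟩
  have c1 : (j - 1) * c / h < 1 := (fl' _ _).2 (by linarith)
  have c1' : 0 ≤ (j - 1) * c / h := (fl _ _).2 (by nlinarith)
  have c2 : 1 ≤ j * c / h := (fl _ _).2 (by linarith)
  have c3 : 1 ≤ (j + q - 1) * c / h := (fl _ _).2 (by nlinarith)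
  have c4 : (j - q) * c / h < 1 := (fl' _ _).2 (by nlinarith)
  have b1 : (j - 1) * b / h ≤ j * b / h := Int.ediv_le_ediv hh (by nlinarith)
  have b2 : (j - q) * b / h + 1 ≤ (j + q - 1) * b / h := by
    rw [fl]
    have := (fl ((j - q) * b) _).1 le_rfl
    nlinarith
  have m1 : (j - 1) * m < (N + 1) * h := (fl' _ _).1 (by omega)
  have m2 : (N + 1) * h ≤ j * m := (fl _ _).1 (by omega)
  have m3 : (j + q - 1) * m / h < N + 2 := (fl' _ _).2 (by nlinarith)
  have m4 : N ≤ (j - q) * m / h := (fl _ _).2 (by nlinarith)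
  omega

theorem ediv_complement {h x : ℤ} (hh : 0 < h) (hx : ¬ h ∣ x) : (-x) / h = -1 - x / h := by
  have h1 := Int.mul_ediv_add_emod x h
  have h2 := Int.emod_nonneg x hh.ne'
  have h3 := Int.emod_lt_of_pos x hh
  have h4 : x % h ≠ 0 := fun h => hx (Int.dvd_of_emod_eq_zero h)
  have h5 : 0 < x % h := by omega
  rw [Int.ediv_eq_iff_of_pos hh]
  constructor <;> nlinarith

/-- Since b + c - 1 = h - a, complementing the floor of j a / h turns `H` into ⌊j (b + c - 1) / h⌋ =
⌊j b / h⌋ + ⌊j c / h⌋, which `not_floor_merge` excludes for `c ≥ 2`. The case j = 2 supplies the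
bound 2 (b + c - 1) ≤ h. -/
theorem one_of_floor_sum_sorted {h a b c : ℤ} (hc : 1 ≤ c) (hcb : c ≤ b) (hba : b ≤ a)
    (hs : a + b + c = h + 1) (hd : ∀ j, 1 ≤ j → j < h → ¬ h ∣ j * a)
    (H : ∀ j, 1 ≤ j → j < h → j * a / h + j * b / h + j * c / h = j - 1) : c = 1 := by
  by_contra hc1
  have hc2 : 2 ≤ c := by omega
  have hh : 0 < h := by omega
  have h2a : h ≤ 2 * a := by
    by_contra hcon
    push Not at hcon
    have h1 := H 2 (by omega) (by omega)
    rw [Int.ediv_eq_zero_of_lt (by omega) hcon, Int.ediv_eq_zero_of_lt (by omega) (by omega),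
      Int.ediv_eq_zero_of_lt (by omega) (by omega)] at h1
    omega
  refine not_floor_merge hc2 hcb (h := h) (by omega) fun j hj0 hj => ?_
  rcases hj0.eq_or_lt with rfl | hj0
  · simp
  have h1 := H j (by omega) hj
  have h2 : j * (b + c - 1) = -(j * a) + j * h := by
    have : b + c - 1 = h - a := by omega
    rw [this]; ring
  rw [h2, Int.add_mul_ediv_right _ _ hh.ne', ediv_complement hh (hd j (by omega) hj)]
  omega

theorem one_of_floor_sum {h a b c : ℤ} (ha : 1 ≤ a) (hb : 1 ≤ b) (hc : 1 ≤ c)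
    (hs : a + b + c = h + 1)
    (hda : ∀ j, 1 ≤ j → j < h → ¬ h ∣ j * a) (hdb : ∀ j, 1 ≤ j → j < h → ¬ h ∣ j * b)
    (hdc : ∀ j, 1 ≤ j → j < h → ¬ h ∣ j * c)
    (H : ∀ j, 1 ≤ j → j < h → j * a / h + j * b / h + j * c / h = j - 1) :
    a = 1 ∨ b = 1 ∨ c = 1 := by
  rcases le_total a b with h1 | h1 <;> rcases le_total b c with h2 | h2 <;>
    rcases le_total a c with h3 | h3
  · exact .inl (one_of_floor_sum_sorted ha h1 h2 (by omega) hdc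
      fun j p q => by have := H j p q; omega)
  · exact .inl (one_of_floor_sum_sorted ha h1 h2 (by omega) hdc
      fun j p q => by have := H j p q; omega)
  · exact .inl (one_of_floor_sum_sorted ha h3 h2 (by omega) hdb
      fun j p q => by have := H j p q; omega)
  · exact .inr (.inr (one_of_floor_sum_sorted hc h3 h1 (by omega) hdb
      fun j p q => by have := H j p q; omega))
  · exact .inr (.inl (one_of_floor_sum_sorted hb h1 h3 (by omega) hdc
      fun j p q => by have := H j p q; omega))
  · exact .inr (.inl (one_of_floor_sum_sorted hb h2 h3 (by omega) hda
      fun j p q => by have := H j p q; omega))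
  · exact .inr (.inr (one_of_floor_sum_sorted hc h2 h1 (by omega) hda
      fun j p q => by have := H j p q; omega))
  · exact .inr (.inr (one_of_floor_sum_sorted hc h2 h1 (by omega) hda
      fun j p q => by have := H j p q; omega))

/-- The arithmetic form of White's theorem on empty tetrahedra. -/
theorem white_arithmetic {h A B C : ℤ} (hh : 1 ≤ h) (hs : A + B + C = -1)
    (H : ∀ j, 1 ≤ j → j < h → j * A / h + j * B / h + j * C / h ≤ -2) :
    h ∣ A + 1 ∨ h ∣ B + 1 ∨ h ∣ C + 1 := by
  rcases hh.eq_or_lt with rfl | h1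
  · exact .inl (one_dvd _)
  have h0 : 0 < h := by omega
  have comp : ∀ j X : ℤ, (h - j) * X / h = X + (-(j * X)) / h := fun j X => by
    rw [show (h - j) * X = -(j * X) + X * h by ring, Int.add_mul_ediv_right _ _ h0.ne', add_comm]
  have compd : ∀ x : ℤ, h ∣ x → (-x) / h = - (x / h) := fun x hx => Int.neg_ediv_of_dvd hx
  -- The floor sums at `j` and `h - j` add up to -1 minus the number of products not divisible by
  -- `h`, hence to at least -4. As both are at most -2, equality holds throughout.
  have key : ∀ j, 1 ≤ j → j < h → (¬ h ∣ j * A ∧ ¬ h ∣ j * B ∧ ¬ h ∣ j * C) ∧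
      j * A / h + j * B / h + j * C / h = -2 := by
    intro j hj hjh
    have e1 := H j hj hjh
    have e2 := H (h - j) (by omega) (by omega)
    rw [comp, comp, comp] at e2
    have tri : ∀ X : ℤ, (h ∣ j * X ∧ (-(j * X)) / h = - (j * X / h)) ∨
        (¬ h ∣ j * X ∧ (-(j * X)) / h = -1 - j * X / h) := fun X => by
      by_cases hx : h ∣ j * X
      · exact .inl ⟨hx, compd _ hx⟩
      · exact .inr ⟨hx, ediv_complement h0 hx⟩
    rcases tri A with ⟨a1, a2⟩ | ⟨a1, a2⟩ <;> rcases tri B with ⟨b1, b2⟩ | ⟨b1, b2⟩ <;>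
      rcases tri C with ⟨c1, c2⟩ | ⟨c1, c2⟩ <;> rw [a2, b2, c2] at e2 <;>
      first
      | exact absurd e2 (by omega)
      | exact ⟨⟨a1, b1, c1⟩, by omega⟩
  -- Pass to the residues of -A, -B, -C in [1, h - 1]: their sum is h + 1, as `one_of_floor_sum`
  -- needs, and residue 1 means `h ∣ X + 1`.
  have res : ∀ X : ℤ, (∀ j, 1 ≤ j → j < h → ¬ h ∣ j * X) → 1 ≤ (-X) % h ∧
      (-X) % h = -X - h * (-1 - X / h) ∧
      (∀ j, 1 ≤ j → j < h → ¬ h ∣ j * ((-X) % h)) ∧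
      (∀ j, 1 ≤ j → j < h → j * ((-X) % h) / h = -1 - j * X / h + j * (1 + X / h)) ∧
      ((-X) % h = 1 → h ∣ X + 1) := by
    intro X hX
    have hX1 : ¬ h ∣ X := by simpa using hX 1 le_rfl h1
    have e1 := Int.mul_ediv_add_emod (-X) h
    rw [ediv_complement h0 hX1] at e1
    have e0 : (-X) % h = -X - h * (-1 - X / h) := by linarith
    refine ⟨?_, e0, ?_, ?_, ?_⟩
    · have := Int.emod_nonneg (-X) h0.ne'
      have h4 : (-X) % h ≠ 0 := fun h => hX1 ((Int.dvd_neg).1 (Int.dvd_of_emod_eq_zero h))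
      omega
    · intro j hj hjh hdvd
      apply hX j hj hjh
      rw [e0] at hdvd
      have := Int.dvd_add hdvd (Dvd.intro (j * (-1 - X / h)) rfl)
      rw [show j * (-X - h * (-1 - X / h)) + h * (j * (-1 - X / h)) = -(j * X) by ring] at this
      exact (Int.dvd_neg).1 this
    · intro j hj hjh
      rw [e0, show j * (-X - h * (-1 - X / h)) = -(j * X) + (j * (1 + X / h)) * h by ring,
        Int.add_mul_ediv_right _ _ h0.ne', ediv_complement h0 (hX j hj hjh)]
    · intro h2
      rw [e0] at h2
      exact ⟨1 + X / h, by linarith⟩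
  obtain ⟨a1, a2, a3, a4, a5⟩ := res A fun j p q => (key j p q).1.1
  obtain ⟨b1, b2, b3, b4, b5⟩ := res B fun j p q => (key j p q).1.2.1
  obtain ⟨c1, c2, c3, c4, c5⟩ := res C fun j p q => (key j p q).1.2.2
  have k1 := (key 1 le_rfl h1).2
  simp only [one_mul] at k1
  have := one_of_floor_sum a1 b1 c1 (h := h) (by
      rw [a2, b2, c2]
      linear_combination (-1 : ℤ) * hs + h * k1) a3 b3 c3 fun j p q => by
    rw [a4 j p q, b4 j p q, c4 j p q]
    linear_combination j * k1 - (key j p q).2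
  rcases this with h | h | h
  · exact .inl (a5 h)
  · exact .inr (.inl (b5 h))
  · exact .inr (.inr (c5 h))


/-! ### Clean configurations, normal form and White's theorem -/

open Matrix

/-- Five labelled points of `ℤ³`. -/
abbrev Config : Type := Fin 5 → Fin 3 → ℤ

/-- The configurations `p` and `q` differ by an affine automorphism of `ℤ³`. -/
def Config.UEquiv (p q : Config) : Prop :=
  ∃ (M : Matrix (Fin 3) (Fin 3) ℤ) (t : Fin 3 → ℤ), IsUnit M.det ∧ ∀ i, q i = M *ᵥ p i + t

/-- The points `p i` span `ℝ³` affinely, are all the lattice points of their convex hull, and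
satisfy the affine dependence with coefficients `v`. -/
structure Config.IsClean (p : Config) (v : Fin 5 → ℤ) : Prop where
  clean : ∀ (z : Fin 3 → ℤ) (n : Fin 5 → ℤ), (∀ i, 0 ≤ n i) → 0 < ∑ i, n i →
    (∑ i, n i) • z = ∑ i, n i • p i → ∃ i, p i = z
  injective : Function.Injective p
  full : ∀ (α : Fin 3 → ℤ) (δ : ℤ), (∀ i, α ⬝ᵥ p i = δ) → α = 0
  sum_eq_zero : ∑ i, v i = 0
  sum_smul_eq_zero : ∑ i, v i • p i = 0

namespace Config

variable {p q r : Config} {v : Fin 5 → ℤ}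

theorem UEquiv.trans (h : UEquiv p q) (h' : UEquiv q r) : UEquiv p r := by
  obtain ⟨M, t, hM, h⟩ := h
  obtain ⟨N, s, hN, h'⟩ := h'
  refine ⟨N * M, N *ᵥ t + s, by rw [det_mul]; exact hN.mul hM, fun i => ?_⟩
  rw [h', h, mulVec_add, mulVec_mulVec, add_assoc]

theorem UEquiv.comp (h : UEquiv p q) (σ : Equiv.Perm (Fin 5)) : UEquiv (p ∘ σ) (q ∘ σ) := by
  obtain ⟨M, t, hM, h⟩ := h
  exact ⟨M, t, hM, fun i => h (σ i)⟩

theorem IsClean.comp (hp : IsClean p v) (σ : Equiv.Perm (Fin 5)) :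
    IsClean (p ∘ σ) (v ∘ σ) where
  clean z n hn hs h := by
    obtain ⟨i, hi⟩ := hp.clean z (n ∘ σ.symm) (fun i => hn _)
      (by rw [← Equiv.sum_comp σ]; simpa using hs) (by
        rw [← Equiv.sum_comp σ, ← Equiv.sum_comp σ (fun i => (n ∘ σ.symm) i • p i)]
        simpa using h)
    exact ⟨σ.symm i, by simpa using hi⟩
  injective := hp.injective.comp σ.injective
  full α δ h := hp.full α δ fun i => by simpa using h (σ.symm i)
  sum_eq_zero := by
    rw [← hp.sum_eq_zero, ← Equiv.sum_comp σ v]; rfl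
  sum_smul_eq_zero := by
    rw [← hp.sum_smul_eq_zero, ← Equiv.sum_comp σ (fun i => v i • p i)]; rfl

theorem IsClean.neg (hp : IsClean p v) : IsClean p (-v) where
  clean := hp.clean
  injective := hp.injective
  full := hp.full
  sum_eq_zero := by simpa using hp.sum_eq_zero
  sum_smul_eq_zero := by simpa using hp.sum_smul_eq_zero

theorem IsClean.of_uequiv (hp : IsClean p v) (h : UEquiv p q) : IsClean q v := by
  obtain ⟨M, t, hM, h⟩ := h
  have key : ∀ n : Fin 5 → ℤ, ∑ i, n i • q i = M *ᵥ (∑ i, n i • p i) + (∑ i, n i) • t := by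
    intro n
    simp_rw [h, smul_add, Finset.sum_add_distrib, mulVec_sum, mulVec_smul, Finset.sum_smul]
  have inv : ∀ x, M⁻¹ *ᵥ (M *ᵥ x) = x := fun x => by
    rw [mulVec_mulVec, nonsing_inv_mul _ hM, one_mulVec]
  have inv' : ∀ x, M *ᵥ (M⁻¹ *ᵥ x) = x := fun x => by
    rw [mulVec_mulVec, mul_nonsing_inv _ hM, one_mulVec]
  refine ⟨fun z n hn hs hz => ?_, fun i j hij => ?_, fun α δ hα => ?_, hp.sum_eq_zero, ?_⟩
  · obtain ⟨i, hi⟩ := hp.clean (M⁻¹ *ᵥ (z - t)) n hn hs (by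
      rw [← inv (∑ i, n i • p i), ← mulVec_smul, smul_sub, hz, key, add_sub_cancel_right])
    exact ⟨i, by rw [h, hi, inv', sub_add_cancel]⟩
  · rw [h, h] at hij
    apply hp.injective
    rw [← inv (p i), ← inv (p j), add_right_cancel hij]
  · have h0 := hp.full (α ᵥ* M) (δ - α ⬝ᵥ t) fun i => by
      rw [← dotProduct_mulVec, ← hα i, h, dotProduct_add, add_sub_cancel_right]
    have : (α ᵥ* M) ᵥ* M⁻¹ = 0 := by rw [h0, zero_vecMul]
    rwa [vecMul_vecMul, mul_nonsing_inv _ hM, vecMul_one] at this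
  · rw [key, hp.sum_smul_eq_zero, hp.sum_eq_zero]; simp

theorem UEquiv.of_coords {m : Fin 3 → Fin 3 → ℤ} {t : Fin 3 → ℤ}
    (hm : IsUnit (Matrix.of m).det)
    (h : ∀ i j, q i j = m j 0 * p i 0 + m j 1 * p i 1 + m j 2 * p i 2 + t j) : UEquiv p q :=
  ⟨Matrix.of m, t, hm, fun i => funext fun j => by
    simp [h, mulVec, dotProduct, Fin.sum_univ_three]⟩

theorem IsClean.clean_coords (hp : IsClean p v) (x y z n0 n1 n2 n3 n4 : ℤ) (h0 : 0 ≤ n0)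
    (h1 : 0 ≤ n1) (h2 : 0 ≤ n2) (h3 : 0 ≤ n3) (h4 : 0 ≤ n4) (hs : 0 < n0 + n1 + n2 + n3 + n4)
    (hx : (n0 + n1 + n2 + n3 + n4) * x =
      n0 * p 0 0 + n1 * p 1 0 + n2 * p 2 0 + n3 * p 3 0 + n4 * p 4 0)
    (hy : (n0 + n1 + n2 + n3 + n4) * y =
      n0 * p 0 1 + n1 * p 1 1 + n2 * p 2 1 + n3 * p 3 1 + n4 * p 4 1)
    (hz : (n0 + n1 + n2 + n3 + n4) * z =
      n0 * p 0 2 + n1 * p 1 2 + n2 * p 2 2 + n3 * p 3 2 + n4 * p 4 2) :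
    ∃ i, p i 0 = x ∧ p i 1 = y ∧ p i 2 = z := by
  obtain ⟨i, hi⟩ := hp.clean ![x, y, z] ![n0, n1, n2, n3, n4]
    (by simp [Fin.forall_fin_succ, h0, h1, h2, h3, h4])
    (by simpa [Fin.sum_univ_five] using hs) (by
      funext j
      fin_cases j <;> simp [Fin.sum_univ_five, hx, hy, hz])
  exact ⟨i, by simp [hi]⟩

theorem IsClean.rel (hp : IsClean p v) (j : Fin 3) :
    v 0 * p 0 j + v 1 * p 1 j + v 2 * p 2 j + v 3 * p 3 j + v 4 * p 4 j = 0 := by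
  simpa [Fin.sum_univ_five] using congrFun hp.sum_smul_eq_zero j

theorem IsClean.relSum (hp : IsClean p v) : v 0 + v 1 + v 2 + v 3 + v 4 = 0 := by
  simpa [Fin.sum_univ_five] using hp.sum_eq_zero

/-- The extended Euclidean algorithm as a row operation of determinant one, the elementary step of
the Hermite form. -/
theorem exists_bezout_rows (x y : ℤ) :
    ∃ s t s' t' : ℤ, s * t' - t * s' = 1 ∧ s' * x + t' * y = 0 ∧ 0 ≤ s * x + t * y := by
  by_cases h : Int.gcd x y = 0
  · rw [Int.gcd_eq_zero_iff] at h
    exact ⟨1, 0, 0, 1, by simp [h.1, h.2]⟩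
  · obtain ⟨x', hx⟩ : (Int.gcd x y : ℤ) ∣ x := Int.gcd_dvd_left ..
    obtain ⟨y', hy⟩ : (Int.gcd x y : ℤ) ∣ y := Int.gcd_dvd_right ..
    have hb := Int.gcd_eq_gcd_ab x y
    set g : ℤ := ((Int.gcd x y : ℕ) : ℤ) with hg
    have hg0 : g ≠ 0 := by rw [hg]; exact_mod_cast h
    refine ⟨Int.gcdA x y, Int.gcdB x y, -y', x', ?_, ?_, ?_⟩
    · apply mul_left_cancel₀ hg0
      linear_combination (-1 : ℤ) * hb - Int.gcdA x y * hx - Int.gcdB x y * hy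
    · linear_combination (-y') * hx + x' * hy
    · have : 0 ≤ g := by positivity
      linarith

/-- Hermite normal form of the first four points. -/
theorem exists_uequiv_hermite (p : Config) : ∃ q, UEquiv p q ∧
    (q 0 0 = 0 ∧ q 0 1 = 0 ∧ q 0 2 = 0) ∧ (0 ≤ q 1 0 ∧ q 1 1 = 0 ∧ q 1 2 = 0) ∧
    (0 ≤ q 2 1 ∧ q 2 2 = 0) ∧ 0 ≤ q 3 2 := by
  have S1 : ∃ q, UEquiv p q ∧ (q 0 0 = 0 ∧ q 0 1 = 0 ∧ q 0 2 = 0) :=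
    ⟨fun i => p i - p 0, .of_coords (m := ![![1, 0, 0], ![0, 1, 0], ![0, 0, 1]]) (t := - p 0)
      (by simp [det_fin_three]) (by
        intro i j; fin_cases j <;> simp <;> ring), by simp⟩
  obtain ⟨q1, e1, a1, a2, a3⟩ := S1
  have S2 : ∃ q, UEquiv p q ∧ (q 0 0 = 0 ∧ q 0 1 = 0 ∧ q 0 2 = 0) ∧ q 1 2 = 0 := by
    obtain ⟨s, t, s', t', h1, h2, h3⟩ := exists_bezout_rows (q1 1 1) (q1 1 2)
    refine ⟨fun i => ![q1 i 0, s * q1 i 1 + t * q1 i 2, s' * q1 i 1 + t' * q1 i 2],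
      e1.trans (.of_coords (m := ![![1, 0, 0], ![0, s, t], ![0, s', t']]) (t := 0)
      (by simp [det_fin_three, h1]) (by
        intro i j; fin_cases j <;> simp)), by simp [a1, a2, a3], by simpa using h2⟩
  obtain ⟨q2, e2, ⟨b1, b2, b3⟩, b4⟩ := S2
  have S3 : ∃ q, UEquiv p q ∧ (q 0 0 = 0 ∧ q 0 1 = 0 ∧ q 0 2 = 0) ∧
      (0 ≤ q 1 0 ∧ q 1 1 = 0 ∧ q 1 2 = 0) := by
    obtain ⟨s, t, s', t', h1, h2, h3⟩ := exists_bezout_rows (q2 1 0) (q2 1 1)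
    refine ⟨fun i => ![s * q2 i 0 + t * q2 i 1, s' * q2 i 0 + t' * q2 i 1, q2 i 2],
      e2.trans (.of_coords (m := ![![s, t, 0], ![s', t', 0], ![0, 0, 1]]) (t := 0)
      (by simp [det_fin_three, h1]) (by
        intro i j; fin_cases j <;> simp)), by simp [b1, b2, b3],
        by simpa using h3, by simpa using h2, by simpa using b4⟩
  obtain ⟨q3, e3, ⟨c1, c2, c3⟩, c4, c5, c6⟩ := S3
  have S4 : ∃ q, UEquiv p q ∧ (q 0 0 = 0 ∧ q 0 1 = 0 ∧ q 0 2 = 0) ∧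
      (0 ≤ q 1 0 ∧ q 1 1 = 0 ∧ q 1 2 = 0) ∧ (0 ≤ q 2 1 ∧ q 2 2 = 0) := by
    obtain ⟨s, t, s', t', h1, h2, h3⟩ := exists_bezout_rows (q3 2 1) (q3 2 2)
    refine ⟨fun i => ![q3 i 0, s * q3 i 1 + t * q3 i 2, s' * q3 i 1 + t' * q3 i 2],
      e3.trans (.of_coords (m := ![![1, 0, 0], ![0, s, t], ![0, s', t']]) (t := 0)
      (by simp [det_fin_three, h1]) (by
        intro i j; fin_cases j <;> simp)), by simp [c1, c2, c3],
        ⟨by simpa using c4, by simp [c5, c6], by simp [c5, c6]⟩,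
        by simpa using h3, by simpa using h2⟩
  obtain ⟨q4, e4, ⟨d1, d2, d3⟩, ⟨d4, d5, d6⟩, d7, d8⟩ := S4
  rcases le_total 0 (q4 3 2) with h | h
  · exact ⟨q4, e4, ⟨d1, d2, d3⟩, ⟨d4, d5, d6⟩, ⟨d7, d8⟩, h⟩
  · refine ⟨fun i => ![q4 i 0, q4 i 1, - q4 i 2],
      e4.trans (.of_coords (m := ![![1, 0, 0], ![0, 1, 0], ![0, 0, -1]]) (t := 0)
      (by simp [det_fin_three]) (by
        intro i j; fin_cases j <;> simp)), by simp [*], by simp [*], by simp [*], by simpa using h⟩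

/-- The configuration `0, e₁, e₂, (a, b, h), (c, d, -k)`. -/
def normalForm (a b h c d k : ℤ) : Config :=
  ![![0, 0, 0], ![1, 0, 0], ![0, 1, 0], ![a, b, h], ![c, d, -k]]

theorem IsClean.vec_eq_zero (hp : IsClean p v) (α : Fin 3 → ℤ)
    (h : ∀ i, α 0 * p i 0 + α 1 * p i 1 + α 2 * p i 2 = 0) : α = 0 :=
  hp.full α 0 fun i => by simpa [dotProduct, Fin.sum_univ_three] using h i

-- If all coefficients but `v 4` were nonpositive, the fifth point would lie in the hull of the
-- others; `ht` excludes this. Hence the edge from the first to the second point has no further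
-- lattice point, and its lattice length is 1.
set_option maxHeartbeats 1000000 in
theorem IsClean.exists_uequiv_primitive (hp : IsClean p v) (h4 : 0 < v 4)
    (ht : 0 < v 3 ∨ 0 < v 0 ∨ 0 < v 1 ∨ 0 < v 2) :
    ∃ q, UEquiv p q ∧ (q 0 0 = 0 ∧ q 0 1 = 0 ∧ q 0 2 = 0) ∧
      (q 1 0 = 1 ∧ q 1 1 = 0 ∧ q 1 2 = 0) ∧ (0 < q 2 1 ∧ q 2 2 = 0) ∧ 0 < q 3 2 := by
  obtain ⟨q, e, ⟨a1, a2, a3⟩, ⟨b1, b2, b3⟩, ⟨c1, c2⟩, d1⟩ := exists_uequiv_hermite p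
  have hq := hp.of_uequiv e
  have r0 := hq.relSum
  have rx := hq.rel 0
  have ry := hq.rel 1
  have rz := hq.rel 2
  simp only [a1, a2, a3, b2, b3, c2, mul_zero, zero_add] at rx ry rz
  -- the height of the fourth point
  have hh : 0 < q 3 2 := by
    refine d1.lt_of_ne fun h0 => ?_
    rw [← h0, mul_zero, zero_add] at rz
    have h1 : q 4 2 = 0 := by simpa [h4.ne'] using rz
    have := congrFun (hq.vec_eq_zero ![0, 0, 1]
      (by simp [Fin.forall_fin_succ, a3, b3, c2, ← h0, h1])) 2
    simp at this
  have hg : 0 < q 1 0 := by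
    refine b1.lt_of_ne fun h0 => ?_
    have : q 1 = q 0 := by
      funext j; fin_cases j <;> simp [a1, a2, a3, b2, b3, ← h0]
    simpa using hq.injective this
  have hf : 0 < q 2 1 := by
    refine c1.lt_of_ne fun h0 => ?_
    rw [← h0, mul_zero, zero_add] at ry
    have h1 : q 3 2 * q 4 1 - q 3 1 * q 4 2 = 0 := by
      apply mul_left_cancel₀ h4.ne'
      linear_combination q 3 2 * ry - q 3 1 * rz
    have := congrFun (hq.vec_eq_zero ![0, q 3 2, - q 3 1] (by
      simp only [Fin.forall_fin_succ]
      refine ⟨by simp [a1, a2, a3], by simp [b2, b3], by simp [c2, ← h0], ?_, ?_, by simp⟩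
      · simp; ring
      · simp; linarith)) 1
    simp at this
    exact hh.ne' this
  have hv3 : q 4 2 = 0 → v 3 = 0 := fun h0 => by
    rw [h0, mul_zero, add_zero] at rz
    simpa [hh.ne'] using rz
  -- the second point is primitive
  have hg1 : q 1 0 = 1 := by
    obtain ⟨i, hi0, hi1, hi2⟩ := hq.clean_coords 1 0 0 (q 1 0 - 1) 1 0 0 0 (by omega) zero_le_one
      le_rfl le_rfl le_rfl (by omega) (by simp [a1]) (by simp [a2, b2]) (by simp [a3, b3])
    fin_cases i <;> simp only [Fin.reduceFinMk, Fin.isValue, Fin.zero_eta, Fin.mk_one] at hi0 hi1 hi2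
    · omega
    · exact hi0
    · omega
    · omega
    · have e3 := hv3 hi2
      rw [e3, hi1] at ry
      have e2 : v 2 = 0 := by simpa [hf.ne'] using ry
      rw [e3, e2, hi0] at rx
      rw [e3, e2] at r0
      have e1 : v 1 < 0 := by nlinarith
      have e0 : v 0 ≤ 0 := by nlinarith
      omega
  exact ⟨q, e, ⟨a1, a2, a3⟩, ⟨hg1, b2, b3⟩, ⟨hf, c2⟩, hh⟩

-- The third point is sheared to satisfy 0 ≤ x < y. The base triangle contains no lattice point
-- besides its vertices, which forces y = 1. The last point is not above the base because v₃ h = v₄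
-- k with `0 ≤ v 3`.
set_option maxHeartbeats 1000000 in
theorem IsClean.exists_normalForm (hp : IsClean p v) (h4 : 0 < v 4) (h3 : 0 ≤ v 3)
    (ht : 0 < v 3 ∨ 0 < v 0 ∨ 0 < v 1 ∨ 0 < v 2) :
    ∃ a b h c d k, 1 ≤ h ∧ 0 ≤ k ∧ UEquiv p (normalForm a b h c d k) := by
  obtain ⟨q, e, ⟨a1, a2, a3⟩, ⟨b1, b2, b3⟩, ⟨hf, c2⟩, hh⟩ := hp.exists_uequiv_primitive h4 ht
  have hq := hp.of_uequiv e
  have r0 := hq.relSum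
  have rz := hq.rel 2
  simp only [a3, b3, c2, mul_zero, zero_add] at rz
  have hv3 : q 4 2 = 0 → v 3 = 0 := fun h0 => by
    rw [h0, mul_zero, add_zero] at rz
    simpa [hh.ne'] using rz
  obtain ⟨q', e', hq'⟩ : ∃ q', UEquiv q q' ∧ ∀ i, q' i 0 = q i 0 - (q 2 0 / q 2 1) * q i 1 ∧
      q' i 1 = q i 1 ∧ q' i 2 = q i 2 :=
    ⟨fun i => ![q i 0 - (q 2 0 / q 2 1) * q i 1, q i 1, q i 2],
      .of_coords (m := ![![1, -(q 2 0 / q 2 1), 0], ![0, 1, 0], ![0, 0, 1]]) (t := 0)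
      (by simp [det_fin_three]) (by
        intro i j; fin_cases j <;> simp; ring), by simp⟩
  have hc' := hq.of_uequiv e'
  have s0 : 0 ≤ q' 2 0 := by
    rw [(hq' 2).1]; have := Int.ediv_mul_le (q 2 0) hf.ne'; linarith
  have s1 : q' 2 0 < q' 2 1 := by
    rw [(hq' 2).1, (hq' 2).2.1]; have := Int.lt_ediv_add_one_mul_self (q 2 0) hf; linarith
  have t0 : q' 0 0 = 0 ∧ q' 0 1 = 0 ∧ q' 0 2 = 0 := by simp [*]
  have t1 : q' 1 0 = 1 ∧ q' 1 1 = 0 ∧ q' 1 2 = 0 := by simp [*]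
  have t2 : q' 2 2 = 0 := by simp [*]
  have t3 : 0 < q' 3 2 := by simpa [hq'] using hh
  have hf' : 0 < q' 2 1 := by simpa [hq'] using hf
  have hv3' : q' 4 2 = 0 → v 3 = 0 := by simpa [hq'] using hv3
  have rx' := hc'.rel 0
  have ry' := hc'.rel 1
  have rz' := hc'.rel 2
  simp only [t0, t1, t2, mul_zero, zero_add, mul_one] at rx' ry' rz'
  have hf1 : q' 2 1 = 1 := by
    by_contra hne
    have h2 : 2 ≤ q' 2 1 := by omega
    rcases s0.eq_or_lt with s0 | s0
    · obtain ⟨i, hi0, hi1, hi2⟩ := hc'.clean_coords 0 1 0 (q' 2 1 - 1) 0 1 0 0 (by omega) le_rfl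
        zero_le_one le_rfl le_rfl (by omega) (by simp [t0, ← s0]) (by simp [t0]) (by simp [t0, t2])
      fin_cases i <;>
        simp only [Fin.reduceFinMk, Fin.isValue, Fin.zero_eta, Fin.mk_one] at hi0 hi1 hi2
      · omega
      · omega
      · omega
      · omega
      · rw [hv3' hi2] at rx' ry' r0
        rw [hi0, ← s0] at rx'
        rw [hi1] at ry'
        have e1 : v 1 = 0 := by linarith
        have e2 : v 2 < 0 := by nlinarith
        have e0 : v 0 ≤ 0 := by nlinarith
        have := hv3' hi2
        omega
    -- With third point (x, y, 0), the weights x - 1, y - x, 1 of total y place (1, 1, 0) in the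
    -- triangle.
    · obtain ⟨i, hi0, hi1, hi2⟩ := hc'.clean_coords 1 1 0 (q' 2 0 - 1) (q' 2 1 - q' 2 0) 1 0 0
        (by omega) (by omega) zero_le_one le_rfl le_rfl (by omega) (by simp [t0, t1])
        (by simp [t0, t1]) (by simp [t0, t1, t2])
      fin_cases i <;>
        simp only [Fin.reduceFinMk, Fin.isValue, Fin.zero_eta, Fin.mk_one] at hi0 hi1 hi2
      · omega
      · omega
      · omega
      · omega
      · rw [hv3' hi2] at rx' ry' r0
        rw [hi0] at rx'
        rw [hi1] at ry'
        have e2 : v 2 < 0 := by nlinarith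
        have e1 : v 1 ≤ 0 := by nlinarith
        have e0 : v 0 ≤ 0 := by nlinarith
        have := hv3' hi2
        omega
  have hk : 0 ≤ - q' 4 2 := by
    by_contra hcon
    push Not at hcon
    have h5 : 0 < q' 4 2 := by omega
    have := mul_pos h4 h5
    have := mul_nonneg h3 t3.le
    linarith
  refine ⟨q' 3 0, q' 3 1, q' 3 2, q' 4 0, q' 4 1, - q' 4 2, t3, hk, ?_⟩
  convert e.trans e' using 1
  funext i j
  fin_cases i <;> fin_cases j <;> simp [normalForm, t0, t1, t2, hf1]
  omega

/-- White's theorem for the tetrahedron on the first four points of a clean configuration: some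
integral functional takes the same value on two of its vertices, and the next value on the other
two. -/
theorem IsClean.exists_white (hp : IsClean p v) (h4 : 0 < v 4) (h3 : 0 ≤ v 3)
    (ht : 0 < v 3 ∨ 0 < v 0 ∨ 0 < v 1 ∨ 0 < v 2) :
    ∃ α : Fin 3 → ℤ,
      (α ⬝ᵥ (p 1 - p 0) = 0 ∧ α ⬝ᵥ (p 2 - p 0) = 1 ∧ α ⬝ᵥ (p 3 - p 0) = 1) ∨
      (α ⬝ᵥ (p 1 - p 0) = 1 ∧ α ⬝ᵥ (p 2 - p 0) = 0 ∧ α ⬝ᵥ (p 3 - p 0) = 1) ∨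
      (α ⬝ᵥ (p 1 - p 0) = 1 ∧ α ⬝ᵥ (p 2 - p 0) = 1 ∧ α ⬝ᵥ (p 3 - p 0) = 0) := by
  obtain ⟨a, b, h, c, d, k, hh, hk, e⟩ := hp.exists_normalForm h4 h3 ht
  have hq := hp.of_uequiv e
  have h0 : 0 < h := by omega
  have W : h ∣ -a + 1 ∨ h ∣ -b + 1 ∨ h ∣ (a + b - 1) + 1 := by
    -- At level `j` the candidate is (⌈ja/h⌉, ⌈jb/h⌉, j). Its weights at e₁ and e₂ are division
    -- remainders and its weight at 0 is nonnegative once the three floors sum to at least -1, so it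
    -- would be an extra lattice point.
    refine white_arithmetic hh (by ring) fun j hj hjh => ?_
    by_contra hcon
    push Not at hcon
    have fa := Int.ediv_mul_le (j * -a) h0.ne'
    have fb := Int.ediv_mul_le (j * -b) h0.ne'
    have fc := Int.ediv_mul_le (j * (a + b - 1)) h0.ne'
    set x := j * -a / h
    set y := j * -b / h
    set w := j * (a + b - 1) / h
    have hw : 0 ≤ (x + y + w + 1) * h := mul_nonneg (by omega) h0.le
    obtain ⟨i, -, -, hi⟩ := hq.clean_coords (-x) (-y) j (h + h * x + h * y + j * (a + b - 1))
      (- h * x - j * a) (- h * y - j * b) j 0 (by linarith) (by linarith) (by linarith) (by omega)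
      le_rfl (by linarith) (by change _ = _ * 0 + _ * 1 + _ * 0 + _ * a + _ * c; ring)
      (by change _ = _ * 0 + _ * 0 + _ * 1 + _ * b + _ * d; ring)
      (by change _ = _ * 0 + _ * 0 + _ * 0 + _ * h + _ * -k; ring)
    fin_cases i <;> simp [normalForm] at hi <;> omega
  obtain ⟨M, t, hM, e⟩ := e
  have tr : ∀ (α : Fin 3 → ℤ) i, (α ᵥ* M) ⬝ᵥ (p i - p 0) =
      α ⬝ᵥ (normalForm a b h c d k i - normalForm a b h c d k 0) := fun α i => by
    rw [e, e, ← dotProduct_mulVec, mulVec_sub, add_sub_add_right_eq_sub]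
  rcases W with ⟨s, hs⟩ | ⟨s, hs⟩ | ⟨s, hs⟩
  · refine ⟨![1, 0, s] ᵥ* M, .inr (.inl ?_)⟩
    simp only [tr]
    simp [normalForm]
    linarith
  · refine ⟨![0, 1, s] ᵥ* M, .inl ?_⟩
    simp only [tr]
    simp [normalForm]
    linarith
  · refine ⟨![1, 1, -s] ᵥ* M, .inr (.inr ?_)⟩
    simp only [tr]
    simp [normalForm]
    linarith

end Config

/-! ### Signatures that force width one -/

namespace Config

variable {p q r : Config} {v : Fin 5 → ℤ} {a b h c d k n : ℤ}

/-- Some nonconstant integral functional takes values in `[m, m + n]` on the configuration. -/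
def HasWidthLE (n : ℤ) (p : Config) : Prop :=
  ∃ α : Fin 3 → ℤ, α ≠ 0 ∧ ∃ m : ℤ, ∀ i, m ≤ α ⬝ᵥ p i ∧ α ⬝ᵥ p i ≤ m + n

theorem HasWidthLE.of_uequiv (hq : HasWidthLE n q) (h : UEquiv p q) : HasWidthLE n p := by
  obtain ⟨M, t, hM, h⟩ := h
  obtain ⟨α, hα, m, hm⟩ := hq
  refine ⟨α ᵥ* M, fun h0 => hα ?_, m - α ⬝ᵥ t, fun i => ?_⟩
  · have : (α ᵥ* M) ᵥ* M⁻¹ = 0 := by rw [h0, zero_vecMul]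
    rwa [vecMul_vecMul, mul_nonsing_inv _ hM, vecMul_one] at this
  · have := hm i
    rw [h, dotProduct_add, dotProduct_mulVec] at this
    constructor <;> linarith

theorem HasWidthLE.of_comp {σ : Equiv.Perm (Fin 5)} (h : HasWidthLE n (p ∘ σ)) :
    HasWidthLE n p := by
  obtain ⟨α, hα, m, hm⟩ := h
  exact ⟨α, hα, m, fun i => by simpa using hm (σ.symm i)⟩

/-- Some nonconstant integral functional takes values in `{m, m + 1}` on the configuration. -/
abbrev HasWidthOne (p : Config) : Prop := HasWidthLE 1 p

theorem hasWidthOne_normalForm (α β γ m : ℤ) (h0 : α ≠ 0 ∨ β ≠ 0 ∨ γ ≠ 0)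
    (e0 : m ≤ 0 ∧ 0 ≤ m + 1) (e1 : m ≤ α ∧ α ≤ m + 1) (e2 : m ≤ β ∧ β ≤ m + 1)
    (e3 : m ≤ α * a + β * b + γ * h ∧ α * a + β * b + γ * h ≤ m + 1)
    (e4 : m ≤ α * c + β * d - γ * k ∧ α * c + β * d - γ * k ≤ m + 1) :
    HasWidthOne (normalForm a b h c d k) := by
  refine ⟨![α, β, γ], ?_, m, ?_⟩
  · rintro h
    have h1 := congrFun h 0
    have h2 := congrFun h 1
    have h3 := congrFun h 2
    simp at h1 h2 h3
    simp [h1, h2, h3] at h0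
  · simp only [Fin.forall_fin_succ, normalForm, dotProduct, Fin.sum_univ_three]
    simp
    exact ⟨e0, e1, e2, e3, by constructor <;> linarith⟩

section NormalForm

variable (hq : IsClean (normalForm a b h c d k) v)
include hq

theorem IsClean.normalForm_rel : v 1 + v 3 * a + v 4 * c = 0 ∧ v 2 + v 3 * b + v 4 * d = 0 ∧
    v 3 * h = v 4 * k ∧ v 0 + v 1 + v 2 + v 3 + v 4 = 0 := by
  have rx := hq.rel 0
  have ry := hq.rel 1
  have rz := hq.rel 2
  simp [normalForm] at rx ry rz
  exact ⟨rx, ry, by linarith, hq.relSum⟩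

theorem IsClean.normalForm_clean (x y z n0 n1 n2 n3 n4 : ℤ) (h0 : 0 ≤ n0)
    (h1 : 0 ≤ n1) (h2 : 0 ≤ n2) (h3 : 0 ≤ n3) (h4 : 0 ≤ n4) (hs : 0 < n0 + n1 + n2 + n3 + n4)
    (hx : (n0 + n1 + n2 + n3 + n4) * x = n1 + n3 * a + n4 * c)
    (hy : (n0 + n1 + n2 + n3 + n4) * y = n2 + n3 * b + n4 * d)
    (hz : (n0 + n1 + n2 + n3 + n4) * z = n3 * h - n4 * k) :
    (x = 0 ∧ y = 0 ∧ z = 0) ∨ (x = 1 ∧ y = 0 ∧ z = 0) ∨ (x = 0 ∧ y = 1 ∧ z = 0) ∨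
      (x = a ∧ y = b ∧ z = h) ∨ (x = c ∧ y = d ∧ z = -k) := by
  obtain ⟨i, hi0, hi1, hi2⟩ := hq.clean_coords x y z n0 n1 n2 n3 n4 h0 h1 h2 h3 h4 hs
    (by change _ = _ * 0 + _ * 1 + _ * 0 + _ * a + _ * c; linarith)
    (by change _ = _ * 0 + _ * 0 + _ * 1 + _ * b + _ * d; linarith)
    (by change _ = _ * 0 + _ * 0 + _ * 0 + _ * h + _ * -k; linarith)
  fin_cases i <;> simp [normalForm] at hi0 hi1 hi2 <;> omega

/-- White's theorem read modulo the volume `h`: one of the barycentric coordinates x, y, 1 - x - y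
of the base triangle is congruent to 1 at the point (a, b, h). -/
theorem IsClean.normalForm_white (h4 : 0 < v 4) (h3 : 0 ≤ v 3)
    (ht : 0 < v 3 ∨ 0 < v 0 ∨ 0 < v 1 ∨ 0 < v 2) : h ∣ a - 1 ∨ h ∣ b - 1 ∨ h ∣ a + b := by
  obtain ⟨α, H⟩ := hq.exists_white h4 h3 ht
  simp [normalForm, dotProduct, Fin.sum_univ_three] at H
  rcases H with ⟨e1, e2, e3⟩ | ⟨e1, e2, e3⟩ | ⟨e1, e2, e3⟩ <;> rw [e1, e2] at e3
  · exact .inr (.inl ⟨-α 2, by linarith⟩)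
  · exact .inl ⟨-α 2, by linarith⟩
  · exact .inr (.inr ⟨-α 2, by linarith⟩)

theorem IsClean.normalForm_white_34 (h3 : 0 < v 3) (h4 : 0 < v 4) :
    k ∣ c - 1 ∨ k ∣ d - 1 ∨ k ∣ c + d := by
  obtain ⟨α, H⟩ := (hq.comp (Equiv.swap 3 4)).exists_white (by simpa using h3)
    (by simpa using h4.le) (.inl (by simpa using h4))
  simp [normalForm, dotProduct, Fin.sum_univ_three, Equiv.swap_apply_def] at H
  rcases H with ⟨e1, e2, e3⟩ | ⟨e1, e2, e3⟩ | ⟨e1, e2, e3⟩ <;> rw [e1, e2] at e3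
  · exact .inr (.inl ⟨α 2, by linarith⟩)
  · exact .inl ⟨α 2, by linarith⟩
  · exact .inr (.inr ⟨α 2, by linarith⟩)

/-- White's theorem for the tetrahedron with e₁ replaced by the fifth point; α, β, γ are the
coefficients of its functional. -/
theorem IsClean.normalForm_white_14 (h1 : 0 < v 1) (h3 : 0 ≤ v 3) (h4 : 0 < v 4) :
    ∃ α β γ : ℤ,
      (α * c + β * d - γ * k = 0 ∧ β = 1 ∧ α * a + β * b + γ * h = 1) ∨
      (α * c + β * d - γ * k = 1 ∧ β = 0 ∧ α * a + β * b + γ * h = 1) ∨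
      (α * c + β * d - γ * k = 1 ∧ β = 1 ∧ α * a + β * b + γ * h = 0) := by
  obtain ⟨α, H⟩ := (hq.comp (Equiv.swap 1 4)).exists_white (by simpa using h1)
    (by simpa [Equiv.swap_apply_def] using h3)
    (.inr (.inr (.inl (by simpa [Equiv.swap_apply_def] using h4))))
  simp [normalForm, dotProduct, Fin.sum_univ_three, Equiv.swap_apply_def] at H
  exact ⟨α 0, α 1, α 2, by simpa [sub_eq_add_neg] using H⟩

theorem IsClean.normalForm_white_24 (h2 : 0 < v 2) (h3 : 0 ≤ v 3) (h4 : 0 < v 4) :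
    ∃ α β γ : ℤ,
      (α = 0 ∧ α * c + β * d - γ * k = 1 ∧ α * a + β * b + γ * h = 1) ∨
      (α = 1 ∧ α * c + β * d - γ * k = 0 ∧ α * a + β * b + γ * h = 1) ∨
      (α = 1 ∧ α * c + β * d - γ * k = 1 ∧ α * a + β * b + γ * h = 0) := by
  obtain ⟨α, H⟩ := (hq.comp (Equiv.swap 2 4)).exists_white (by simpa using h2)
    (by simpa [Equiv.swap_apply_def] using h3)
    (.inr (.inr (.inr (by simpa [Equiv.swap_apply_def] using h4))))
  simp [normalForm, dotProduct, Fin.sum_univ_three, Equiv.swap_apply_def] at H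
  exact ⟨α 0, α 1, α 2, by simpa [sub_eq_add_neg] using H⟩

theorem IsClean.normalForm_white_04 (h0 : 0 < v 0) (h3 : 0 ≤ v 3) (h4 : 0 < v 4) :
    ∃ α β γ : ℤ, ∃ e : ℤ, α * c + β * d - γ * k = e ∧
      ((α - e = 0 ∧ β - e = 1 ∧ α * a + β * b + γ * h - e = 1) ∨
      (α - e = 1 ∧ β - e = 0 ∧ α * a + β * b + γ * h - e = 1) ∨
      (α - e = 1 ∧ β - e = 1 ∧ α * a + β * b + γ * h - e = 0)) := by
  obtain ⟨α, H⟩ := (hq.comp (Equiv.swap 0 4)).exists_white (by simpa using h0)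
    (by simpa [Equiv.swap_apply_def] using h3)
    (.inr (.inl (by simpa [Equiv.swap_apply_def] using h4)))
  simp [normalForm, dotProduct, Fin.sum_univ_three, Equiv.swap_apply_def] at H
  refine ⟨α 0, α 1, α 2, _, rfl, ?_⟩
  rcases H with ⟨e1, e2, e3⟩ | ⟨e1, e2, e3⟩ | ⟨e1, e2, e3⟩
  · exact .inl ⟨by linarith, by linarith, by linarith⟩
  · exact .inr (.inl ⟨by linarith, by linarith, by linarith⟩)
  · exact .inr (.inr ⟨by linarith, by linarith, by linarith⟩)

end NormalForm

/-- Three collinear points. -/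
theorem IsClean.hasWidthOne_of_collinear (hp : IsClean p v) (h1 : 0 < v 1) (h2 : v 2 = 0)
    (h3 : v 3 = 0) (h14 : v 1 ≤ v 4) : HasWidthOne p := by
  have h4 : 0 < v 4 := by omega
  obtain ⟨a, b, h, c, d, k, hh, hk, e⟩ := hp.exists_normalForm h4 h3.ge (.inr (.inr (.inl h1)))
  refine HasWidthLE.of_uequiv ?_ e
  have hq := hp.of_uequiv e
  obtain ⟨rx, ry, rz, -⟩ := hq.normalForm_rel
  simp only [h2, h3, zero_mul, zero_add, add_zero] at rx ry rz
  obtain rfl : k = 0 := by simpa [h4.ne'] using rz.symm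
  obtain rfl : d = 0 := by simpa [h4.ne'] using ry
  -- Since v₁ = -c v₄ and 0 < v₁ ≤ v₄, the origin is the midpoint of e₁ and the last point.
  obtain rfl : c = -1 := by
    have u1 : c < 0 := by nlinarith
    have u2 : -1 ≤ c := by nlinarith
    omega
  have hb : h ∣ b - 1 → HasWidthOne (normalForm a b h (-1) 0 0) := fun ⟨s, hs⟩ =>
    hasWidthOne_normalForm 0 1 (-s) 0 (by simp) (by simp) (by simp) (by simp)
      (by constructor <;> linarith) (by simp)
  have hb0 : h ∣ b → HasWidthOne (normalForm a b h (-1) 0 0) := fun ⟨s, hs⟩ =>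
    hasWidthOne_normalForm 0 1 (-s) 0 (by simp) (by simp) (by simp) (by simp)
      (by constructor <;> linarith) (by simp)
  have hh2 : h ≤ 2 → HasWidthOne (normalForm a b h (-1) 0 0) := fun h2 => by
    obtain rfl | rfl : h = 1 ∨ h = 2 := by omega
    · exact hb (one_dvd _)
    · rcases Int.even_or_odd' b with ⟨s, hs | hs⟩
      · exact hb0 ⟨s, hs⟩
      · exact hb ⟨s, by omega⟩
  obtain ⟨α, β, γ, W⟩ := hq.normalForm_white_14 h1 h3.ge h4
  have W2 : h ∣ b - 1 ∨ h ∣ a + 1 ∨ h ∣ a - b := by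
    rcases W with ⟨e1, e2, e3⟩ | ⟨e1, e2, e3⟩ | ⟨e1, e2, e3⟩
    · obtain rfl : α = 0 := by linarith
      exact .inl ⟨-γ, by rw [e2] at e3; linarith⟩
    · obtain rfl : α = -1 := by linarith
      exact .inr (.inl ⟨γ, by rw [e2] at e3; linarith⟩)
    · obtain rfl : α = -1 := by linarith
      exact .inr (.inr ⟨γ, by rw [e2] at e3; linarith⟩)
  have two : h ∣ 2 → HasWidthOne (normalForm a b h (-1) 0 0) := fun h2 =>
    hh2 (Int.le_of_dvd (by norm_num) h2)
  rcases hq.normalForm_white h4 h3.ge (.inr (.inr (.inl h1))) with w1 | w1 | w1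
  · rcases W2 with w2 | w2 | w2
    · exact hb w2
    · exact two (by have := Int.dvd_sub w2 w1; ring_nf at this; exact this)
    · exact hb (by have := Int.dvd_sub w1 w2; ring_nf at this ⊢; exact this)
  · exact hb w1
  · rcases W2 with w2 | w2 | w2
    · exact hb w2
    · exact hb (by have := Int.dvd_sub w1 w2; ring_nf at this ⊢; exact this)
    · obtain ⟨s, hs⟩ : h ∣ 2 * a := by have := Int.dvd_add w1 w2; ring_nf at this ⊢; exact this
      obtain ⟨t, ht⟩ : h ∣ 2 * b := by have := Int.dvd_sub w1 w2; ring_nf at this ⊢; exact this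
      by_contra hcon
      -- Both 2a and 2b are divisible by `h`; for h > 2 the point 2/h of the way from 0 to (a, b, h)
      -- is an extra lattice point.
      have h2 : 2 < h := by
        by_contra h2
        exact hcon (hh2 (by omega))
      have := hq.normalForm_clean s t 2 (h - 2) 0 0 2 0 (by omega) le_rfl le_rfl (by norm_num)
        le_rfl (by omega) (by linarith) (by linarith) (by linarith)
      omega

/-- Four coplanar points in convex position. -/
theorem IsClean.hasWidthOne_of_parallelogram (hp : IsClean p v) (h0 : 0 < v 0) (h1 : v 1 < 0)
    (h2 : v 2 < 0) (h3 : v 3 = 0) (h04 : v 0 ≤ v 4) : HasWidthOne p := by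
  have h4 : 0 < v 4 := by omega
  obtain ⟨a, b, h, c, d, k, hh, hk, e⟩ := hp.exists_normalForm h4 h3.ge (.inr (.inl h0))
  refine HasWidthLE.of_uequiv ?_ e
  have hq := hp.of_uequiv e
  obtain ⟨rx, ry, rz, rs⟩ := hq.normalForm_rel
  simp only [h3, zero_mul, add_zero] at rx ry rz rs
  obtain rfl : k = 0 := by simpa [h4.ne'] using rz.symm
  have hc : 0 < c := by nlinarith
  have hd : 0 < d := by nlinarith
  -- From v₀ = (c + d - 1) v₄ ≤ v₄; so the four coplanar points form a unit parallelogram.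
  have hcd : c + d ≤ 2 := by nlinarith
  obtain rfl : c = 1 := by omega
  obtain rfl : d = 1 := by omega
  have ha : ∀ s, a - 1 = h * s ∨ a = h * s → HasWidthOne (normalForm a b h 1 1 0) := fun s hs =>
    hasWidthOne_normalForm 1 0 (-s) 0 (by simp) (by simp) (by simp) (by simp)
      (by rcases hs with hs | hs <;> constructor <;> linarith) (by simp)
  have hb : ∀ s, b - 1 = h * s ∨ b = h * s → HasWidthOne (normalForm a b h 1 1 0) := fun s hs =>
    hasWidthOne_normalForm 0 1 (-s) 0 (by simp) (by simp) (by simp) (by simp)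
      (by rcases hs with hs | hs <;> constructor <;> linarith) (by simp)
  rcases hq.normalForm_white h4 h3.ge (.inr (.inl h0)) with ⟨s, hs⟩ | ⟨s, hs⟩ | w1
  · exact ha s (.inl hs)
  · exact hb s (.inl hs)
  obtain ⟨α, β, γ, ε, he, W⟩ := hq.normalForm_white_04 h0 h3.ge h4
  rcases W with ⟨e1, e2, e3⟩ | ⟨e1, e2, e3⟩ | ⟨e1, e2, e3⟩
  · obtain rfl : β = 0 := by linarith
    obtain rfl : α = -1 := by linarith
    obtain rfl : ε = -1 := by linarith
    exact ha γ (.inr (by linarith))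
  · obtain rfl : α = 0 := by linarith
    obtain rfl : β = -1 := by linarith
    obtain rfl : ε = -1 := by linarith
    exact hb γ (.inr (by linarith))
  · obtain rfl : α = -1 := by linarith
    obtain rfl : β = -1 := by linarith
    obtain rfl : ε = -2 := by linarith
    have w2 : h ∣ 2 := by
      have := Int.dvd_sub w1 (⟨γ, by linarith⟩ : h ∣ a + b - 2)
      ring_nf at this; exact this
    have := Int.le_of_dvd (by norm_num) w2
    obtain rfl | rfl : h = 1 ∨ h = 2 := by omega
    · exact ha a (.inr (by ring))
    · rcases Int.even_or_odd' a with ⟨s, hs | hs⟩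
      · exact ha s (.inr hs)
      · exact ha s (.inl (by omega))

/-- Here `a` and `c` are the values of one barycentric coordinate at the ends of the segment, and
(ka + hc)/(h + k) is its value, strictly between 0 and 1, where the segment crosses the triangle.
With a = 1 + hs and c = 1 + kt this gives hk < h + k, so one of `h`, `k` is 1, and s + t = -1. -/
theorem exists_level_of_same {a c h k : ℤ} (hh : 1 ≤ h) (hk : 1 ≤ k) (ha : h ∣ a - 1)
    (hc : k ∣ c - 1) (h1 : 0 < k * a + h * c) (h2 : k * a + h * c < h + k) :
    ∃ γ, (0 ≤ a + γ * h ∧ a + γ * h ≤ 1) ∧ (0 ≤ c - γ * k ∧ c - γ * k ≤ 1) := by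
  obtain ⟨s, hs⟩ := ha
  obtain ⟨t, ht⟩ := hc
  have e1 : a = 1 + h * s := by linarith
  have e2 : c = 1 + k * t := by linarith
  subst e1 e2
  have hhk : 0 < h * k := by positivity
  have h3 : h * k * (s + t) < 0 := by nlinarith
  have h4 : s + t < 0 := by nlinarith
  have h5 : 0 < h + k + h * k * (s + t) := by nlinarith
  have h6 : h = 1 ∨ k = 1 := by
    by_contra hcon
    push Not at hcon
    have : 2 ≤ h := by omega
    have : 2 ≤ k := by omega
    nlinarith
  have h7 : s + t = -1 := by
    have : -2 < s + t := by rcases h6 with rfl | rfl <;> nlinarith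
    omega
  obtain rfl : t = -1 - s := by omega
  rcases h6 with rfl | rfl
  · exact ⟨-s - 1, by constructor <;> constructor <;> nlinarith⟩
  · exact ⟨-s, by constructor <;> constructor <;> nlinarith⟩

/-- The ends of the segment are normalized in different coordinates. Once a = d = 1, the crossing
point gives kb' > -h, hc' > -k and kb' + hc' < 0. These force b' = 0 or c' = 0, and that coordinate
is then 0 or 1 at both ends. -/
theorem exists_level_of_ne {a b c d h k : ℤ} (hh : 1 ≤ h) (hk : 1 ≤ k) (ha : h ∣ a - 1)
    (hd : k ∣ d - 1) (h1 : 0 < k * a + h * c) (h2 : 0 < k * b + h * d)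
    (h3 : k * a + h * c + (k * b + h * d) < h + k) :
    (∃ γ, (0 ≤ a + γ * h ∧ a + γ * h ≤ 1) ∧ (0 ≤ c - γ * k ∧ c - γ * k ≤ 1)) ∨
    (∃ γ, (0 ≤ b + γ * h ∧ b + γ * h ≤ 1) ∧ (0 ≤ d - γ * k ∧ d - γ * k ≤ 1)) := by
  obtain ⟨s, hs⟩ := ha
  obtain ⟨t, ht⟩ := hd
  -- shear so that `a = 1` and `d = 1`
  obtain ⟨c', hc⟩ : ∃ c', c' = c + s * k := ⟨_, rfl⟩
  obtain ⟨b', hb⟩ : ∃ b', b' = b + t * h := ⟨_, rfl⟩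
  have e1 : 0 < k + h * c' := by
    rw [hc]; linear_combination h1 + k * hs
  have e2 : 0 < k * b' + h := by
    rw [hb]; linear_combination h2 + h * ht
  have e3 : k * b' + h * c' < 0 := by
    rw [hb, hc]; linear_combination h3 - k * hs - h * ht
  have bc : b' = 0 ∨ c' = 0 := by
    by_contra hcon
    push Not at hcon
    rcases lt_or_gt_of_ne hcon.1 with u | u <;> rcases lt_or_gt_of_ne hcon.2 with w | w
    · nlinarith
    · nlinarith
    · nlinarith
    · nlinarith
  rcases bc with h0 | h0
  · exact .inr ⟨t, by constructor <;> constructor <;> linarith⟩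
  · exact .inl ⟨-s, by constructor <;> constructor <;> linarith⟩

/-- A segment crossing a triangle. -/
theorem IsClean.hasWidthOne_of_bipyramid (hp : IsClean p v) (h0 : v 0 < 0) (h1 : v 1 < 0)
    (h2 : v 2 < 0) (h3 : 0 < v 3) (h4 : 0 < v 4) : HasWidthOne p := by
  obtain ⟨a, b, h, c, d, k, hh, hk, e⟩ := hp.exists_normalForm h4 h3.le (.inl h3)
  refine HasWidthLE.of_uequiv ?_ e
  have hq := hp.of_uequiv e
  obtain ⟨rx, ry, rz, rs⟩ := hq.normalForm_rel
  have hk : 0 < k := by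
    have : 0 < v 4 * k := by rw [← rz]; positivity
    exact pos_of_mul_pos_right this h4.le
  -- Times 1/(h + k), the three quantities are the barycentric coordinates of the crossing point.
  have p1 : 0 < k * a + h * c := by
    have : v 4 * (k * a + h * c) = h * (-v 1) := by
      linear_combination h * rx - a * rz
    exact pos_of_mul_pos_right (this ▸ mul_pos (by omega) (by omega)) h4.le
  have p2 : 0 < k * b + h * d := by
    have : v 4 * (k * b + h * d) = h * (-v 2) := by
      linear_combination h * ry - b * rz
    exact pos_of_mul_pos_right (this ▸ mul_pos (by omega) (by omega)) h4.le
  have p0 : 0 < k * (1 - a - b) + h * (1 - c - d) := by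
    have : v 4 * (k * (1 - a - b) + h * (1 - c - d)) = h * (-v 0) := by
      linear_combination h * rs - h * rx - h * ry - (1 - a - b) * rz
    exact pos_of_mul_pos_right (this ▸ mul_pos (by omega) (by omega)) h4.le
  -- Adding γz to a barycentric coordinate keeps its values 0 and 1 on the triangle, so only the two
  -- ends need checking.
  have f1 : (∃ γ, (0 ≤ a + γ * h ∧ a + γ * h ≤ 1) ∧ (0 ≤ c - γ * k ∧ c - γ * k ≤ 1)) →
      HasWidthOne (normalForm a b h c d k) := fun ⟨γ, u, w⟩ =>
    hasWidthOne_normalForm 1 0 γ 0 (by simp) (by simp) (by simp) (by simp) (by simpa using u)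
      (by simpa using w)
  have f2 : (∃ γ, (0 ≤ b + γ * h ∧ b + γ * h ≤ 1) ∧ (0 ≤ d - γ * k ∧ d - γ * k ≤ 1)) →
      HasWidthOne (normalForm a b h c d k) := fun ⟨γ, u, w⟩ =>
    hasWidthOne_normalForm 0 1 γ 0 (by simp) (by simp) (by simp) (by simp) (by simpa using u)
      (by simpa using w)
  have f0 : (∃ γ, (0 ≤ (1 - a - b) + γ * h ∧ (1 - a - b) + γ * h ≤ 1) ∧
      (0 ≤ (1 - c - d) - γ * k ∧ (1 - c - d) - γ * k ≤ 1)) →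
      HasWidthOne (normalForm a b h c d k) := fun ⟨γ, u, w⟩ =>
    hasWidthOne_normalForm (-1) (-1) γ (-1) (by simp) (by simp) (by simp) (by simp)
      (by constructor <;> linarith) (by constructor <;> linarith)
  have g : ∀ {n x y : ℤ}, n ∣ x + y → n ∣ 1 - x - y - 1 := fun {n x y} hn => by
    have := (Int.dvd_neg).2 hn
    ring_nf at this ⊢; exact this
  rcases hq.normalForm_white h4 h3.le (.inl h3) with wa | wa | wa <;>
    rcases hq.normalForm_white_34 h3 h4 with wb | wb | wb
  · exact f1 (exists_level_of_same hh hk wa wb p1 (by linarith))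
  · exact (exists_level_of_ne hh hk wa wb p1 p2 (by linarith)).elim f1 f2
  · exact (exists_level_of_ne hh hk wa (g wb) p1 p0 (by linarith)).elim f1 f0
  · exact (exists_level_of_ne hh hk wa wb p2 p1 (by linarith)).elim f2 f1
  · exact f2 (exists_level_of_same hh hk wa wb p2 (by linarith))
  · exact (exists_level_of_ne hh hk wa (g wb) p2 p0 (by linarith)).elim f2 f0
  · exact (exists_level_of_ne hh hk (g wa) wb p0 p1 (by linarith)).elim f0 f1
  · exact (exists_level_of_ne hh hk (g wa) wb p0 p2 (by linarith)).elim f0 f2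
  · exact f0 (exists_level_of_same hh hk (g wa) (g wb) p0 (by linarith))

end Config

/-! ### The nine representatives and signatures (3,1) and (4,1) -/

namespace Config

variable {p q r : Config} {v : Fin 5 → ℤ} {a b h c d k : ℤ}

/-- The nine configurations of width two; the last one has signature `(3, 1)`. -/
def reps : Fin 9 → Config :=
  ![normalForm 0 0 1 (-1) (-1) 1, normalForm 1 1 2 (-1) (-1) 1, normalForm 1 1 3 (-1) (-1) 2,
    normalForm 1 3 5 (-1) (-2) 3, normalForm 1 3 5 (-1) (-3) 4, normalForm 1 5 7 (-1) (-4) 5,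
    normalForm 2 5 7 (-2) (-4) 5, normalForm 1 2 5 (-2) (-3) 5, normalForm 1 2 3 (-1) (-1) 0]

/-- The configuration is equivalent to a relabelling of one of the nine representatives. -/
def IsRep (p : Config) : Prop :=
  ∃ (j : Fin 9) (σ : Equiv.Perm (Fin 5)), UEquiv p (reps j ∘ σ)

theorem IsRep.of_uequiv (hq : IsRep q) (h : UEquiv p q) : IsRep p := by
  obtain ⟨j, σ, e⟩ := hq
  exact ⟨j, σ, h.trans e⟩

theorem IsRep.of_comp {σ : Equiv.Perm (Fin 5)} (h : IsRep (p ∘ σ)) : IsRep p := by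
  obtain ⟨j, τ, e⟩ := h
  refine ⟨j, σ.symm.trans τ, ?_⟩
  have := e.comp σ.symm
  rw [Function.comp_assoc, Function.comp_assoc] at this
  simpa using this

theorem isRep_of (j : Fin 9) (f : Fin 5 → Fin 5) (m : Fin 3 → Fin 3 → ℤ)
    (hf : Function.Injective f)
    (hm : |m 0 0 * (m 1 1 * m 2 2 - m 1 2 * m 2 1) - m 0 1 * (m 1 0 * m 2 2 - m 1 2 * m 2 0) +
      m 0 2 * (m 1 0 * m 2 1 - m 1 1 * m 2 0)| = 1)
    (h : ∀ i l, reps j (f i) l = m l 0 * p i 0 + m l 1 * p i 1 + m l 2 * p i 2) : IsRep p := by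
  refine ⟨j, Equiv.ofBijective f (Finite.injective_iff_bijective.1 hf),
    .of_coords (m := m) (t := 0) ?_ fun i l => by simpa using h i l⟩
  rw [Int.isUnit_iff_abs_eq, ← hm, det_fin_three]
  simp only [of_apply]
  congr 1
  ring

/-- The form in which a sixth lattice point is exhibited: all of `H` is decidable for numerical
data. The origin carries no weight, being interior to the hull of the other points in the
tetrahedral case. -/
theorem IsClean.false_of_witness (hq : IsClean (normalForm a b h c d k) v)
    (x y z n1 n2 n3 n4 : ℤ)
    (H : (0 ≤ n1 ∧ 0 ≤ n2 ∧ 0 ≤ n3 ∧ 0 ≤ n4 ∧ 0 < n1 + n2 + n3 + n4) ∧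
      ((n1 + n2 + n3 + n4) * x = n1 + n3 * a + n4 * c ∧
      (n1 + n2 + n3 + n4) * y = n2 + n3 * b + n4 * d ∧
      (n1 + n2 + n3 + n4) * z = n3 * h - n4 * k) ∧
      ¬((x = 0 ∧ y = 0 ∧ z = 0) ∨ (x = 1 ∧ y = 0 ∧ z = 0) ∨ (x = 0 ∧ y = 1 ∧ z = 0) ∨
      (x = a ∧ y = b ∧ z = h) ∨ (x = c ∧ y = d ∧ z = -k))) : False :=
  H.2.2 (hq.normalForm_clean x y z 0 n1 n2 n3 n4 le_rfl H.1.1 H.1.2.1 H.1.2.2.1 H.1.2.2.2.1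
    (by simpa using H.1.2.2.2.2) (by simpa using H.2.1.1) (by simpa using H.2.1.2.1)
    (by simpa using H.2.1.2.2))

/-- Shears along the base plane shift (a, b) by multiples of `h` and (c, d) by the opposite
multiples of `k`; the two residue classes cannot be adjusted independently. -/
theorem uequiv_shear (a b h c d k s t : ℤ) :
    UEquiv (normalForm a b h c d k)
      (normalForm (a + s * h) (b + t * h) h (c - s * k) (d - t * k) k) :=
  .of_coords (m := ![![1, 0, s], ![0, 1, t], ![0, 0, 1]]) (t := 0) (by simp [det_fin_three])
    (by
      intro i j
      fin_cases i <;> fin_cases j <;> simp [normalForm] <;> ring)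

theorem uequiv_swap (a b h c d k : ℤ) :
    UEquiv (normalForm a b h c d k ∘ Equiv.swap 1 2) (normalForm b a h d c k) :=
  .of_coords (m := ![![0, 1, 0], ![1, 0, 0], ![0, 0, 1]]) (t := 0) (by simp [det_fin_three])
    (by
      intro i j
      fin_cases i <;> fin_cases j <;> simp [normalForm, Equiv.swap_apply_def])

/-! ### A triangle with an interior point, and an apex -/

/-- The hypotheses are White's conditions for the three tetrahedra joining the apex to the triangles
around the interior point. Each of the 27 combinations is settled by an integral linear combination.
-/
theorem pyramid_index {a b h : ℤ} (w1 : h ∣ a - 1 ∨ h ∣ b - 1 ∨ h ∣ a + b)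
    (w2 : h ∣ b - a - 1 ∨ h ∣ a + 1 ∨ h ∣ b - 2 * a)
    (w3 : h ∣ b + 1 ∨ h ∣ a - b - 1 ∨ h ∣ a - 2 * b) :
    h ∣ 2 ∨ h ∣ 3 ∨ (h ∣ 3 * a ∧ h ∣ 3 * b) := by
  rcases w1 with ⟨x, e1⟩ | ⟨x, e1⟩ | ⟨x, e1⟩ <;> rcases w2 with ⟨y, e2⟩ | ⟨y, e2⟩ | ⟨y, e2⟩ <;>
    rcases w3 with ⟨z, e3⟩ | ⟨z, e3⟩ | ⟨z, e3⟩
  · exact .inr (.inl ⟨-x - y + z, by linear_combination (-1 : ℤ) * e1 - e2 + e3⟩)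
  · exact .inl ⟨-y - z, by linear_combination (-1 : ℤ) * e2 - e3⟩
  · exact .inr (.inl ⟨-x - 2 * y - z, by linear_combination (-1 : ℤ) * e1 - 2 * e2 - e3⟩)
  · exact .inl ⟨-x + y, by linear_combination (-1 : ℤ) * e1 + e2⟩
  · exact .inl ⟨-x + y, by linear_combination (-1 : ℤ) * e1 + e2⟩
  · exact .inl ⟨-x + y, by linear_combination (-1 : ℤ) * e1 + e2⟩
  · exact .inr (.inl ⟨(-2) * x - y + z, by linear_combination (-2) * e1 - e2 + e3⟩)
  · exact .inl ⟨-x - y - z, by linear_combination (-1 : ℤ) * e1 - e2 - e3⟩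
  · exact .inr (.inl ⟨(-3) * x - 2 * y - z, by linear_combination (-3) * e1 - 2 * e2 - e3⟩)
  · exact .inl ⟨-x + z, by linear_combination (-1 : ℤ) * e1 + e3⟩
  · exact .inl ⟨-y - z, by linear_combination (-1 : ℤ) * e2 - e3⟩
  · exact .inl ⟨-x - y - z, by linear_combination (-1 : ℤ) * e1 - e2 - e3⟩
  · exact .inl ⟨-x + z, by linear_combination (-1 : ℤ) * e1 + e3⟩
  · exact .inr (.inl ⟨-x + y - z, by linear_combination (-1 : ℤ) * e1 + e2 - e3⟩)
  · exact .inr (.inl ⟨(-2) * x + y - z, by linear_combination (-2) * e1 + e2 - e3⟩)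
  · exact .inl ⟨-x + z, by linear_combination (-1 : ℤ) * e1 + e3⟩
  · exact .inr (.inl ⟨-x - y - 2 * z, by linear_combination (-1 : ℤ) * e1 - e2 - 2 * e3⟩)
  · exact .inr (.inl ⟨(-3) * x - y - 2 * z, by linear_combination (-3) * e1 - e2 - 2 * e3⟩)
  · exact .inr (.inl ⟨-x - y + 2 * z, by linear_combination (-1 : ℤ) * e1 - e2 + 2 * e3⟩)
  · exact .inl ⟨-y - z, by linear_combination (-1 : ℤ) * e2 - e3⟩
  · exact .inr (.inl ⟨-x - 3 * y - 2 * z, by linear_combination (-1 : ℤ) * e1 - 3 * e2 - 2 * e3⟩)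
  · exact .inl ⟨-x + y + z, by linear_combination (-1 : ℤ) * e1 + e2 + e3⟩
  · exact .inr (.inl ⟨-x + 2 * y - z, by linear_combination (-1 : ℤ) * e1 + 2 * e2 - e3⟩)
  · exact .inr (.inl ⟨(-2) * x + 3 * y - z, by linear_combination (-2) * e1 + 3 * e2 - e3⟩)
  · exact .inr (.inl ⟨(-2) * x - y + 3 * z, by linear_combination (-2) * e1 - e2 + 3 * e3⟩)
  · exact .inr (.inl ⟨-x - 2 * y - 3 * z, by linear_combination (-1 : ℤ) * e1 - 2 * e2 - 3 * e3⟩)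
  · exact .inr (.inr ⟨⟨x - y, by linear_combination e1 - e2⟩,
      ⟨2 * x + y, by linear_combination 2 * e1 + e2⟩⟩)

/-- A lattice point at height one arises as the mean of the apex and two base points. Modulo 3 the
base points are 0, e₁, e₂, -e₁ - e₂, and their pairwise sums with repetition exclude every residue
of (a, b) but (1, 2) and (2, 1), which a swap identifies. -/
theorem IsClean.isRep_of_height_three (hq : IsClean (normalForm a b 3 (-1) (-1) 0) v) :
    IsRep (normalForm a b 3 (-1) (-1) 0) := by
  obtain ⟨s, hs⟩ : ∃ s, s = a / 3 := ⟨_, rfl⟩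
  obtain ⟨t, ht⟩ : ∃ t, t = b / 3 := ⟨_, rfl⟩
  have key : ∀ x y n0 n1 n2 n4 : ℤ, 0 ≤ n0 → 0 ≤ n1 → 0 ≤ n2 → 0 ≤ n4 → n0 + n1 + n2 + n4 = 2 →
      3 * x = n1 + a - n4 → 3 * y = n2 + b - n4 → False := by
    intro x y n0 n1 n2 n4 h0 h1 h2 h4 hs' h5 h6
    have hN : n0 + n1 + n2 + 1 + n4 = 3 := by omega
    have := hq.normalForm_clean x y 1 n0 n1 n2 1 n4 h0 h1 h2 zero_le_one h4 (by omega)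
      (by rw [hN]; linarith) (by rw [hN]; linarith) (by rw [hN]; linarith)
    omega
  obtain e1 | e1 | e1 : a = 3 * s ∨ a = 3 * s + 1 ∨ a = 3 * s + 2 := by omega
  all_goals obtain e2 | e2 | e2 : b = 3 * t ∨ b = 3 * t + 1 ∨ b = 3 * t + 2 := by omega
  · exact (key s t 2 0 0 0 (by simp) (by simp) (by simp) (by simp) (by simp) (by omega)
      (by omega)).elim
  · exact (key s (t + 1) 0 0 2 0 (by simp) (by simp) (by simp) (by simp) (by simp) (by omega)
      (by omega)).elim
  · exact (key s (t + 1) 1 0 1 0 (by simp) (by simp) (by simp) (by simp) (by simp) (by omega)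
      (by omega)).elim
  · exact (key (s + 1) t 0 2 0 0 (by simp) (by simp) (by simp) (by simp) (by simp) (by omega)
      (by omega)).elim
  · exact (key s t 1 0 0 1 (by simp) (by simp) (by simp) (by simp) (by simp) (by omega)
      (by omega)).elim
  · have := uequiv_shear a b 3 (-1) (-1) 0 (-s) (-t)
    rw [show a + -s * 3 = 1 by omega, show b + -t * 3 = 2 by omega, mul_zero, sub_zero, mul_zero,
      sub_zero] at this
    exact ⟨8, 1, by simpa [reps] using this⟩
  · exact (key (s + 1) t 1 1 0 0 (by simp) (by simp) (by simp) (by simp) (by simp) (by omega)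
      (by omega)).elim
  · have := uequiv_shear a b 3 (-1) (-1) 0 (-s) (-t)
    rw [show a + -s * 3 = 2 by omega, show b + -t * 3 = 1 by omega, mul_zero, sub_zero, mul_zero,
      sub_zero] at this
    refine IsRep.of_uequiv (IsRep.of_comp (σ := Equiv.swap 1 2) ?_) this
    exact ⟨8, 1, by simpa [reps] using uequiv_swap 2 1 3 (-1) (-1) 0⟩
  · exact (key s t 0 0 0 2 (by simp) (by simp) (by simp) (by simp) (by simp) (by omega)
      (by omega)).elim

theorem IsClean.hasWidthOne_or_isRep_of_pyramid (hp : IsClean p v) (h1 : 0 < v 1) (h2 : 0 < v 2)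
    (h3 : v 3 = 0) (h14 : v 1 ≤ v 4) (h24 : v 2 ≤ v 4) : HasWidthOne p ∨ IsRep p := by
  have h4 : 0 < v 4 := by omega
  obtain ⟨a, b, h, c, d, k, hh, hk, e⟩ := hp.exists_normalForm h4 h3.ge (.inr (.inr (.inl h1)))
  suffices HasWidthOne (normalForm a b h c d k) ∨ IsRep (normalForm a b h c d k) from
    this.imp (·.of_uequiv e) (·.of_uequiv e)
  have hq := hp.of_uequiv e
  obtain ⟨rx, ry, rz, -⟩ := hq.normalForm_rel
  simp only [h3, zero_mul, add_zero] at rx ry rz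
  obtain rfl : k = 0 := by simpa [h4.ne'] using rz.symm
  obtain rfl : d = -1 := by
    have u1 : d < 0 := by nlinarith
    have u2 : -1 ≤ d := by nlinarith
    omega
  obtain rfl : c = -1 := by
    have u1 : c < 0 := by nlinarith
    have u2 : -1 ≤ c := by nlinarith
    omega
  have w1 := hq.normalForm_white h4 h3.ge (.inr (.inr (.inl h1)))
  have w2 : h ∣ b - a - 1 ∨ h ∣ a + 1 ∨ h ∣ b - 2 * a := by
    obtain ⟨α, β, γ, ⟨e1, e2, e3⟩ | ⟨e1, e2, e3⟩ | ⟨e1, e2, e3⟩⟩ :=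
      hq.normalForm_white_14 h1 h3.ge h4 <;> rw [e2] at e1 e3
    · obtain rfl : α = -1 := by linarith
      exact .inl ⟨-γ, by linarith⟩
    · obtain rfl : α = -1 := by linarith
      exact .inr (.inl ⟨γ, by linarith⟩)
    · obtain rfl : α = -2 := by linarith
      exact .inr (.inr ⟨-γ, by linarith⟩)
  have w3 : h ∣ b + 1 ∨ h ∣ a - b - 1 ∨ h ∣ a - 2 * b := by
    obtain ⟨α, β, γ, ⟨e1, e2, e3⟩ | ⟨e1, e2, e3⟩ | ⟨e1, e2, e3⟩⟩ :=
      hq.normalForm_white_24 h2 h3.ge h4 <;> rw [e1] at e2 e3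
    · obtain rfl : β = -1 := by linarith
      exact .inl ⟨γ, by linarith⟩
    · obtain rfl : β = -1 := by linarith
      exact .inr (.inl ⟨-γ, by linarith⟩)
    · obtain rfl : β = -2 := by linarith
      exact .inr (.inr ⟨-γ, by linarith⟩)
  have h3 : h ≤ 3 := by
    rcases pyramid_index w1 w2 w3 with w | w | ⟨⟨s, hs⟩, ⟨t, ht⟩⟩
    · linarith [Int.le_of_dvd (by norm_num) w]
    · exact Int.le_of_dvd (by norm_num) w
    -- Otherwise the point 3/h of the way from 0 to the apex is an extra lattice point.
    · by_contra hcon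
      have := hq.normalForm_clean s t 3 (h - 3) 0 0 3 0 (by omega) le_rfl le_rfl (by norm_num)
        le_rfl (by omega) (by linarith) (by linarith) (by linarith)
      omega
  obtain rfl | rfl | rfl : h = 1 ∨ h = 2 ∨ h = 3 := by omega
  · exact .inl (hasWidthOne_normalForm 0 0 1 0 (by simp) (by simp) (by simp) (by simp) (by simp)
      (by simp))
  · exfalso
    -- The four base points represent all classes modulo 2, so the apex has an integral midpoint
    -- with one of them.
    have key : ∀ x y n0 n1 n2 n4 : ℤ, 0 ≤ n0 → 0 ≤ n1 → 0 ≤ n2 → 0 ≤ n4 →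
        n0 + n1 + n2 + n4 = 1 → 2 * x = n1 + a - n4 → 2 * y = n2 + b - n4 → False := by
      intro x y n0 n1 n2 n4 h0 h1 h2 h4 hs' h5 h6
      have hN : n0 + n1 + n2 + 1 + n4 = 2 := by omega
      have := hq.normalForm_clean x y 1 n0 n1 n2 1 n4 h0 h1 h2 zero_le_one h4 (by omega)
        (by rw [hN]; linarith) (by rw [hN]; linarith) (by rw [hN]; linarith)
      omega
    rcases Int.even_or_odd' a with ⟨s, hs | hs⟩ <;> rcases Int.even_or_odd' b with ⟨t, ht | ht⟩
    · exact key s t 1 0 0 0 (by simp) (by simp) (by simp) (by simp) (by simp) (by omega) (by omega)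
    · exact key s (t + 1) 0 0 1 0 (by simp) (by simp) (by simp) (by simp) (by simp) (by omega)
        (by omega)
    · exact key (s + 1) t 0 1 0 0 (by simp) (by simp) (by simp) (by simp) (by simp) (by omega)
        (by omega)
    · exact key s t 0 0 0 1 (by simp) (by simp) (by simp) (by simp) (by simp) (by omega)
        (by omega)
  · exact .inr hq.isRep_of_height_three

end Config

namespace Config

variable {p q r : Config} {v : Fin 5 → ℤ} {a b h c d k : ℤ}

/-! ### Tetrahedra with an interior point

The interior point is `0`, and the volumes of the four tetrahedra that it spans with the facets are
`-(k * a + h * c)`, `-(k * b + h * d)`, `k` and `h`. -/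

/-- A normal form of a tetrahedron with interior point `0`, the last two vertices having the
largest coefficients in the affine dependence. -/
structure IsTet (a b h c d k : ℤ) (v : Fin 5 → ℤ) : Prop where
  clean : IsClean (normalForm a b h c d k) v
  height_pos : 1 ≤ h
  pos1 : 0 < v 1
  pos2 : 0 < v 2
  le13 : v 1 ≤ v 3
  le23 : v 2 ≤ v 3
  le34 : v 3 ≤ v 4

namespace IsTet

/-- The dependence is a positive multiple of the vector of volumes, so the ordering of `v` passes to
the volumes. -/
theorem bounds (T : IsTet a b h c d k v) : 1 ≤ k ∧ k ≤ h ∧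
    (1 ≤ -(k * a + h * c) ∧ -(k * a + h * c) ≤ k) ∧
    (1 ≤ -(k * b + h * d) ∧ -(k * b + h * d) ≤ k) := by
  obtain ⟨rx, ry, rz, -⟩ := T.clean.normalForm_rel
  have hh := T.height_pos
  have h1 := T.pos1
  have h2 := T.pos2
  have h13 := T.le13
  have h23 := T.le23
  have h34 := T.le34
  have h4 : 0 < v 4 := by omega
  have e1 : v 4 * -(k * a + h * c) = h * v 1 := by linear_combination a * rz - h * rx
  have e2 : v 4 * -(k * b + h * d) = h * v 2 := by linear_combination b * rz - h * ry
  have hk : 0 < k := pos_of_mul_pos_right (a := v 4) (by nlinarith) h4.le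
  refine ⟨hk, le_of_mul_le_mul_left (a := v 4) (by nlinarith) h4,
    ⟨pos_of_mul_pos_right (a := v 4) (by nlinarith) h4.le,
      le_of_mul_le_mul_left (a := v 4) (by nlinarith) h4⟩,
    ⟨pos_of_mul_pos_right (a := v 4) (by nlinarith) h4.le,
      le_of_mul_le_mul_left (a := v 4) (by nlinarith) h4⟩⟩

theorem white (T : IsTet a b h c d k v) : h ∣ a - 1 ∨ h ∣ b - 1 ∨ h ∣ a + b := by
  have := T.pos1; have := T.le13; have := T.le34
  exact T.clean.normalForm_white (by omega) (by omega) (.inl (by omega))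

theorem white' (T : IsTet a b h c d k v) : k ∣ c - 1 ∨ k ∣ d - 1 ∨ k ∣ c + d := by
  have := T.pos1; have := T.le13; have := T.le34
  exact T.clean.normalForm_white_34 (by omega) (by omega)

theorem white1 (T : IsTet a b h c d k v) : ∃ α β γ : ℤ,
    (α * c + β * d - γ * k = 0 ∧ β = 1 ∧ α * a + β * b + γ * h = 1) ∨
    (α * c + β * d - γ * k = 1 ∧ β = 0 ∧ α * a + β * b + γ * h = 1) ∨
    (α * c + β * d - γ * k = 1 ∧ β = 1 ∧ α * a + β * b + γ * h = 0) := by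
  have := T.pos1; have := T.le13; have := T.le34
  exact T.clean.normalForm_white_14 T.pos1 (by omega) (by omega)

theorem white2 (T : IsTet a b h c d k v) : ∃ α β γ : ℤ,
    (α = 0 ∧ α * c + β * d - γ * k = 1 ∧ α * a + β * b + γ * h = 1) ∨
    (α = 1 ∧ α * c + β * d - γ * k = 0 ∧ α * a + β * b + γ * h = 1) ∨
    (α = 1 ∧ α * c + β * d - γ * k = 1 ∧ α * a + β * b + γ * h = 0) := by
  have := T.pos1; have := T.le13; have := T.le34
  exact T.clean.normalForm_white_24 T.pos2 (by omega) (by omega)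

theorem swap (T : IsTet a b h c d k v) : IsTet b a h d c k (v ∘ Equiv.swap 1 2) where
  clean := (T.clean.comp (Equiv.swap 1 2)).of_uequiv (uequiv_swap a b h c d k)
  height_pos := T.height_pos
  pos1 := by simpa using T.pos2
  pos2 := by simpa using T.pos1
  le13 := by simpa [Equiv.swap_apply_def] using T.le23
  le23 := by simpa [Equiv.swap_apply_def] using T.le13
  le34 := by simpa [Equiv.swap_apply_def] using T.le34

theorem isRep_of_swap (H : IsRep (normalForm b a h d c k)) : IsRep (normalForm a b h c d k) :=
  IsRep.of_comp (H.of_uequiv (uequiv_swap a b h c d k))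

theorem isRep_of_shear (T : IsTet a b h c d k v) {a' b' c' d' : ℤ} (s t : ℤ)
    (ha : a' = a + s * h) (hb : b' = b + t * h) (hc : c' = c - s * k) (hd : d' = d - t * k)
    (H : IsTet a' b' h c' d' k v → IsRep (normalForm a' b' h c' d' k)) :
    IsRep (normalForm a b h c d k) := by
  subst ha hb hc hd
  have e := uequiv_shear a b h c d k s t
  exact (H ⟨T.clean.of_uequiv e, T.height_pos, T.pos1, T.pos2, T.le13, T.le23, T.le34⟩).of_uequiv e

theorem le_of_mul_eq {x y n : ℤ} (hn : 0 < n) (e : x * y = n) : x ≤ n :=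
  Int.le_of_dvd hn ⟨y, e.symm⟩

/-- Here h - k and 2k - h are the volumes of the tetrahedra in `white1` and `white2`. Eliminating
the functional makes each divide 2 or 3, so finitely many cases remain, each a representative or
refuted by a sixth lattice point. The other one- and two-parameter families end in the same way. -/
theorem isRep_of_fst_fst (T : IsTet 1 (-2) h (-1) 1 k v) : IsRep (normalForm 1 (-2) h (-1) 1 k) := by
  obtain ⟨-, -, ⟨b1, -⟩, b2, -⟩ := T.bounds
  have hx : h - k ≤ 2 := by
    obtain ⟨α, β, γ, ⟨e1, rfl, e3⟩ | ⟨e1, rfl, e3⟩ | ⟨e1, rfl, e3⟩⟩ := T.white1 <;>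
      exact le_of_mul_eq (y := γ) (by norm_num) (by linarith)
  have hy : 2 * k - h ≤ 3 := by
    obtain ⟨α, β, γ, ⟨rfl, e1, e3⟩ | ⟨rfl, e1, e3⟩ | ⟨rfl, e1, e3⟩⟩ := T.white2
    · exact le_of_mul_eq (y := -γ) (by norm_num) (by linarith)
    · have : 2 * k - h ≤ 2 := le_of_mul_eq (y := -γ) (by norm_num) (by linarith)
      omega
    · exact le_of_mul_eq (y := -γ) (by norm_num) (by linarith)
  obtain ⟨x, hx'⟩ : ∃ x, x = h - k := ⟨_, rfl⟩
  obtain ⟨y, hy'⟩ : ∃ y, y = 2 * k - h := ⟨_, rfl⟩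
  obtain rfl : k = x + y := by omega
  obtain rfl : h = 2 * x + y := by omega
  have hq := T.clean
  obtain rfl | rfl : x = 1 ∨ x = 2 := by omega
  all_goals obtain rfl | rfl | rfl : y = 1 ∨ y = 2 ∨ y = 3 := by omega
  · exact isRep_of 2 ![0, 1, 2, 3, 4] ![![1, 0, 0], ![0, 1, 1], ![0, 0, 1]] (by decide) (by decide) (by decide)
  · exact (hq.false_of_witness 1 (-1) 2 1 0 1 0 (by decide)).elim
  · exact isRep_of 4 ![0, 1, 2, 3, 4] ![![1, 0, 0], ![0, 1, 1], ![0, 0, 1]] (by decide) (by decide) (by decide)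
  · exact isRep_of 3 ![0, 1, 2, 3, 4] ![![1, 0, 0], ![0, 1, 1], ![0, 0, 1]] (by decide) (by decide) (by decide)
  · exact (hq.false_of_witness 1 (-1) 3 1 0 1 0 (by decide)).elim
  · exact isRep_of 5 ![0, 1, 2, 3, 4] ![![1, 0, 0], ![0, 1, 1], ![0, 0, 1]] (by decide) (by decide) (by decide)

theorem isRep_of_fst_double (T : IsTet 1 (-3) (2 * k) (-1) 1 k v) :
    IsRep (normalForm 1 (-3) (2 * k) (-1) 1 k) := by
  obtain ⟨b1, -⟩ := T.bounds
  have hk : k ≤ 3 := by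
    obtain ⟨α, β, γ, ⟨e1, rfl, e3⟩ | ⟨e1, rfl, e3⟩ | ⟨e1, rfl, e3⟩⟩ := T.white1
    · exact le_of_mul_eq (y := γ) (by norm_num) (by linarith)
    · have : k ≤ 2 := le_of_mul_eq (y := γ) (by norm_num) (by linarith)
      omega
    · exact le_of_mul_eq (y := γ) (by norm_num) (by linarith)
  have hq := T.clean
  obtain rfl | rfl | rfl : k = 1 ∨ k = 2 ∨ k = 3 := by omega
  · exact isRep_of 1 ![0, 1, 2, 3, 4] ![![1, 0, 0], ![0, 1, 2], ![0, 0, 1]] (by decide) (by decide) (by decide)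
  · exact (hq.false_of_witness 0 (-1) 1 0 0 1 1 (by decide)).elim
  · exact (hq.false_of_witness 1 (-2) 4 1 0 2 0 (by decide)).elim

theorem isRep_of_equal_one (T : IsTet 1 (-2) h (-2) 1 h v) :
    IsRep (normalForm 1 (-2) h (-2) 1 h) := by
  have hh := T.height_pos
  have hk : h ≤ 5 := by
    obtain ⟨α, β, γ, ⟨e1, rfl, e3⟩ | ⟨e1, rfl, e3⟩ | ⟨e1, rfl, e3⟩⟩ := T.white1
    · exact le_of_mul_eq (y := γ) (by norm_num) (by linarith)
    · have : h ≤ 3 := le_of_mul_eq (y := γ) (by norm_num) (by linarith)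
      omega
    · have : h ≤ 4 := le_of_mul_eq (y := γ) (by norm_num) (by linarith)
      omega
  have hq := T.clean
  obtain rfl | rfl | rfl | rfl | rfl : h = 1 ∨ h = 2 ∨ h = 3 ∨ h = 4 ∨ h = 5 := by omega
  · exact isRep_of 0 ![0, 1, 2, 3, 4] ![![1, 0, -1], ![0, 1, 2], ![0, 0, 1]] (by decide) (by decide) (by decide)
  · exact (hq.false_of_witness (-1) 1 (-1) 0 1 0 1 (by decide)).elim
  · exact (hq.false_of_witness (-1) 0 (-1) 0 0 1 2 (by decide)).elim
  · exact (hq.false_of_witness (-1) 1 (-2) 0 1 0 1 (by decide)).elim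
  -- All four volumes are 5, so their order does not fix the labelling of the vertices.
  · exact isRep_of 7 ![0, 1, 4, 2, 3] ![![1, -2, -1], ![0, -3, -1], ![0, -5, -2]] (by decide) (by decide) (by decide)

theorem isRep_of_equal_two (T : IsTet 1 (-3) h (-2) 2 h v) :
    IsRep (normalForm 1 (-3) h (-2) 2 h) := by
  have hh := T.height_pos
  have hk : h ≤ 6 := by
    obtain ⟨α, β, γ, ⟨e1, rfl, e3⟩ | ⟨e1, rfl, e3⟩ | ⟨e1, rfl, e3⟩⟩ := T.white1
    · exact le_of_mul_eq (y := γ) (by norm_num) (by linarith)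
    · have : h ≤ 3 := le_of_mul_eq (y := γ) (by norm_num) (by linarith)
      omega
    · have : h ≤ 5 := le_of_mul_eq (y := γ) (by norm_num) (by linarith)
      omega
  have hq := T.clean
  obtain rfl | rfl | rfl | rfl | rfl | rfl :
    h = 1 ∨ h = 2 ∨ h = 3 ∨ h = 4 ∨ h = 5 ∨ h = 6 := by omega
  · exact isRep_of 0 ![0, 1, 2, 3, 4] ![![1, 0, -1], ![0, 1, 3], ![0, 0, 1]] (by decide) (by decide) (by decide)
  · exact (hq.false_of_witness (-1) 1 (-1) 1 1 1 5 (by decide)).elim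
  · exact (hq.false_of_witness 1 (-2) 2 1 0 2 0 (by decide)).elim
  · exact (hq.false_of_witness (-1) 1 (-2) 1 1 1 5 (by decide)).elim
  · exact isRep_of 7 ![0, 1, 2, 3, 4] ![![1, 0, 0], ![0, 1, 1], ![0, 0, 1]] (by decide) (by decide) (by decide)
  · exact (hq.false_of_witness (-1) 1 (-3) 1 1 1 5 (by decide)).elim

theorem isRep_of_sum_fst (T : IsTet (-2) 2 h 1 (-2) k v) :
    IsRep (normalForm (-2) 2 h 1 (-2) k) := by
  obtain ⟨-, -, ⟨b1, -⟩, b2, -⟩ := T.bounds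
  have hx : 2 * k - h ≤ 4 := by
    obtain ⟨α, β, γ, ⟨e1, rfl, e3⟩ | ⟨e1, rfl, e3⟩ | ⟨e1, rfl, e3⟩⟩ := T.white1
    · have : 2 * k - h ≤ 3 := le_of_mul_eq (y := -γ) (by norm_num) (by linarith)
      omega
    · have : 2 * k - h ≤ 3 := le_of_mul_eq (y := -γ) (by norm_num) (by linarith)
      omega
    · exact le_of_mul_eq (y := -γ) (by norm_num) (by linarith)
  have hy : h - k ≤ 2 := by
    obtain ⟨α, β, γ, ⟨rfl, e1, e3⟩ | ⟨rfl, e1, e3⟩ | ⟨rfl, e1, e3⟩⟩ := T.white2 <;>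
      exact le_of_mul_eq (y := γ) (by norm_num) (by linarith)
  obtain ⟨x, hx'⟩ : ∃ x, x = 2 * k - h := ⟨_, rfl⟩
  obtain ⟨y, hy'⟩ : ∃ y, y = h - k := ⟨_, rfl⟩
  obtain rfl : k = x + y := by omega
  obtain rfl : h = x + 2 * y := by omega
  have hq := T.clean
  obtain rfl | rfl : y = 1 ∨ y = 2 := by omega
  all_goals obtain rfl | rfl | rfl | rfl : x = 1 ∨ x = 2 ∨ x = 3 ∨ x = 4 := by omega
  · exact (hq.false_of_witness 1 (-1) (-1) 1 0 0 1 (by decide)).elim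
  · exact (hq.false_of_witness (-1) 1 2 1 1 7 2 (by decide)).elim
  · exact (hq.false_of_witness 1 (-1) (-2) 1 0 0 1 (by decide)).elim
  · exact (hq.false_of_witness (-1) 1 3 2 1 11 3 (by decide)).elim
  · exact isRep_of 4 ![0, 1, 3, 2, 4] ![![1, 1, 0], ![0, 3, -1], ![0, 5, -2]] (by decide) (by decide) (by decide)
  · exact (hq.false_of_witness (-1) 1 3 1 2 10 3 (by decide)).elim
  · exact isRep_of 6 ![0, 2, 1, 3, 4] ![![0, 1, 0], ![1, 0, 1], ![0, 0, 1]] (by decide) (by decide) (by decide)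
  · exact (hq.false_of_witness (-1) 1 4 1 1 7 2 (by decide)).elim

theorem isRep_of_sum_double (T : IsTet (-3) 3 (2 * k) 1 (-2) k v) :
    IsRep (normalForm (-3) 3 (2 * k) 1 (-2) k) := by
  obtain ⟨b1, -⟩ := T.bounds
  have hk : k ≤ 6 := by
    obtain ⟨α, β, γ, ⟨e1, rfl, e3⟩ | ⟨e1, rfl, e3⟩ | ⟨e1, rfl, e3⟩⟩ := T.white1
    · have : k ≤ 4 := le_of_mul_eq (y := -γ) (by norm_num) (by linarith)
      omega
    · have : k ≤ 4 := le_of_mul_eq (y := -γ) (by norm_num) (by linarith)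
      omega
    · exact le_of_mul_eq (y := -γ) (by norm_num) (by linarith)
  have hq := T.clean
  obtain rfl | rfl | rfl | rfl | rfl | rfl :
    k = 1 ∨ k = 2 ∨ k = 3 ∨ k = 4 ∨ k = 5 ∨ k = 6 := by omega
  · exact isRep_of 1 ![0, 1, 2, 3, 4] ![![1, 0, 2], ![0, 1, -1], ![0, 0, 1]] (by decide) (by decide) (by decide)
  · exact (hq.false_of_witness 1 (-1) (-1) 1 0 0 1 (by decide)).elim
  · exact (hq.false_of_witness (-2) 2 4 1 1 11 2 (by decide)).elim
  · exact (hq.false_of_witness (-1) 1 3 1 0 2 1 (by decide)).elim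
  · exact (hq.false_of_witness (-1) 1 3 1 6 11 7 (by decide)).elim
  · exact (hq.false_of_witness (-2) 2 8 1 1 11 2 (by decide)).elim

theorem isRep_of_sum_equal (T : IsTet (-2) 2 h 1 (-3) h v) :
    IsRep (normalForm (-2) 2 h 1 (-3) h) := by
  have hh := T.height_pos
  have hk : h ≤ 6 := by
    obtain ⟨α, β, γ, ⟨e1, rfl, e3⟩ | ⟨e1, rfl, e3⟩ | ⟨e1, rfl, e3⟩⟩ := T.white1
    · have : h ≤ 5 := le_of_mul_eq (y := -γ) (by norm_num) (by linarith)
      omega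
    · have : h ≤ 3 := le_of_mul_eq (y := -γ) (by norm_num) (by linarith)
      omega
    · exact le_of_mul_eq (y := -γ) (by norm_num) (by linarith)
  have hq := T.clean
  obtain rfl | rfl | rfl | rfl | rfl | rfl :
    h = 1 ∨ h = 2 ∨ h = 3 ∨ h = 4 ∨ h = 5 ∨ h = 6 := by omega
  · exact isRep_of 0 ![0, 1, 2, 3, 4] ![![1, 0, 2], ![0, 1, -2], ![0, 0, 1]] (by decide) (by decide) (by decide)
  · exact (hq.false_of_witness (-1) 1 1 1 1 5 1 (by decide)).elim
  · exact (hq.false_of_witness 1 (-2) (-2) 1 0 0 2 (by decide)).elim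
  · exact (hq.false_of_witness (-1) 1 2 1 1 5 1 (by decide)).elim
  · exact isRep_of 7 ![0, 1, 2, 4, 3] ![![1, 0, 0], ![0, 1, -1], ![0, 0, -1]] (by decide) (by decide) (by decide)
  · exact (hq.false_of_witness (-1) 1 3 1 1 5 1 (by decide)).elim

/-- If d ≡ 1 mod k, a shear gives d = 1 and the volume bounds leave b = -2, or b = -3 with h = 2k.
Otherwise White's condition at level `k` forces k = 2, and after a shear the midpoint of e₁ and the
last vertex is an extra lattice point. -/
theorem isRep_of_fst_neg_one (T : IsTet 1 b h (-1) d k v) : IsRep (normalForm 1 b h (-1) d k) := by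
  by_cases hd : k ∣ d - 1
  · obtain ⟨t, ht⟩ := hd
    refine T.isRep_of_shear 0 t (a' := 1) (c' := -1) (d' := 1) (by ring) rfl (by ring)
      (by linarith) fun T => ?_
    obtain ⟨c1, c2, ⟨c3, c4⟩, c5, c6⟩ := T.bounds
    generalize b + t * h = b at *
    have u1 : b < -1 := by nlinarith
    have u2 : -4 < b := by nlinarith
    obtain rfl | rfl : b = -2 ∨ b = -3 := by omega
    · exact T.isRep_of_fst_fst
    · obtain rfl : h = 2 * k := by omega
      exact T.isRep_of_fst_double
  · have hk : k ∣ 2 := by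
      rcases T.white' with w | w | w
      · simpa using (Int.dvd_neg).2 w
      · exact absurd w hd
      · rw [show (-1 : ℤ) + d = d - 1 by ring] at w
        exact absurd w hd
    obtain ⟨c1, c2, ⟨c3, c4⟩, c5, c6⟩ := T.bounds
    have := Int.le_of_dvd (by norm_num) hk
    obtain rfl | rfl : k = 1 ∨ k = 2 := by omega
    · exact absurd (one_dvd _) hd
    · obtain ⟨t, ht⟩ : ∃ t, d = 2 * t := ⟨d / 2, by omega⟩
      refine T.isRep_of_shear 0 t (a' := 1) (c' := -1) (d' := 0) (by ring) rfl (by ring)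
        (by linarith) fun T => ?_
      obtain ⟨c1, c2, ⟨c3, c4⟩, c5, c6⟩ := T.bounds
      generalize b + t * h = b at *
      have hq := T.clean
      obtain rfl : b = -1 := by omega
      obtain rfl | rfl : h = 3 ∨ h = 4 := by omega
      · exact (hq.false_of_witness 0 0 (-1) 1 0 0 1 (by decide)).elim
      · exact (hq.false_of_witness 0 0 (-1) 1 0 0 1 (by decide)).elim

/-- With `h = k` the second volume is -h (b + d), which lies in [1, h]; so b + d = -1 and only b mod
h matters. -/
theorem isRep_of_fst_neg_two (T : IsTet 1 b h (-2) d h v) : IsRep (normalForm 1 b h (-2) d h) := by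
  have hh := T.height_pos
  obtain ⟨-, -, -, c1, c2⟩ := T.bounds
  obtain rfl : d = -1 - b := by
    have : b + d < 0 := by nlinarith
    have : -2 < b + d := by nlinarith
    omega
  by_cases hd : h ∣ b + 2
  · obtain ⟨t, ht⟩ := hd
    exact T.isRep_of_shear 0 (-t) (a' := 1) (b' := -2) (c' := -2) (d' := 1) (by ring) (by linarith)
      (by ring) (by linarith) isRep_of_equal_one
  by_cases hd' : h ∣ b + 3
  · obtain ⟨t, ht⟩ := hd'
    exact T.isRep_of_shear 0 (-t) (a' := 1) (b' := -3) (c' := -2) (d' := 2) (by ring) (by linarith)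
      (by ring) (by linarith) isRep_of_equal_two
  rcases T.white' with w | w | w
  · have : h ≤ 3 := Int.le_of_dvd (by norm_num) (by simpa using (Int.dvd_neg).2 w)
    obtain rfl | rfl | rfl : h = 1 ∨ h = 2 ∨ h = 3 := by omega
    · exact absurd (one_dvd _) hd
    · omega
    · refine T.isRep_of_shear 0 (-((b - 2) / 3)) (a' := 1) (b' := 2) (c' := -2) (d' := -3) (by ring)
        (by omega) (by ring) (by omega) fun T => ?_
      have hq := T.clean
      exact (hq.false_of_witness (-1) (-2) (-2) 1 0 0 2 (by decide)).elim
  · rw [show -1 - b - 1 = -(b + 2) by ring, Int.dvd_neg] at w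
    exact absurd w hd
  · rw [show -2 + (-1 - b) = -(b + 3) by ring, Int.dvd_neg] at w
    exact absurd w hd'

/-- After a shear to a = 1, the first volume -(k + hc) lies between 1 and k ≤ h. Hence c is -1 or
-2, the latter only for h = k. -/
theorem isRep_of_dvd_fst (T : IsTet a b h c d k v) (w : h ∣ a - 1) :
    IsRep (normalForm a b h c d k) := by
  obtain ⟨s, hs⟩ := w
  refine T.isRep_of_shear (-s) 0 (a' := 1) (b' := b) (d' := d) (by linarith) (by ring) rfl
    (by ring) fun T => ?_
  generalize c - -s * k = c at *
  obtain ⟨c1, c2, ⟨c3, c4⟩, -⟩ := T.bounds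
  have u1 : c < 0 := by nlinarith
  have u2 : -3 < c := by nlinarith
  obtain rfl | rfl : c = -1 ∨ c = -2 := by omega
  · exact T.isRep_of_fst_neg_one
  · obtain rfl : h = k := by omega
    exact T.isRep_of_fst_neg_two

/-- Shears with opposite amounts in x and y preserve a + b = 0 and can be used to reach c = 1. -/
theorem isRep_of_sum_zero_fst (T : IsTet a (-a) h c d k v) (w : k ∣ c - 1) :
    IsRep (normalForm a (-a) h c d k) := by
  obtain ⟨s, hs⟩ := w
  refine T.isRep_of_shear s (-s) (b' := -(a + s * h)) (c' := 1) rfl (by ring) (by linarith)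
    rfl fun T => ?_
  generalize d - -s * k = d at *
  generalize a + s * h = a at *
  obtain ⟨c1, c2, ⟨c3, c4⟩, c5, c6⟩ := T.bounds
  have hh := T.height_pos
  have u1 : 1 + d < 0 := by nlinarith
  have u2 : -3 < 1 + d := by nlinarith
  obtain rfl | rfl : d = -2 ∨ d = -3 := by omega
  · have u3 : a < -1 := by nlinarith
    have u4 : -4 < a := by nlinarith
    obtain rfl | rfl : a = -2 ∨ a = -3 := by omega
    · exact T.isRep_of_sum_fst
    · obtain rfl : h = 2 * k := by omega
      exact T.isRep_of_sum_double
  · obtain rfl : h = k := by linarith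
    obtain rfl : a = -2 := by
      have : a + 1 < 0 := by nlinarith
      have : -2 < a + 1 := by nlinarith
      omega
    exact T.isRep_of_sum_equal

theorem isRep_of_sum_zero (T : IsTet a (-a) h c d k v) : IsRep (normalForm a (-a) h c d k) := by
  by_cases w1 : k ∣ c - 1
  · exact T.isRep_of_sum_zero_fst w1
  by_cases w2 : k ∣ d - 1
  · refine isRep_of_swap ?_
    have := T.swap
    obtain ⟨a', rfl⟩ : ∃ a', a = -a' := ⟨-a, by ring⟩
    rw [neg_neg] at this ⊢
    exact this.isRep_of_sum_zero_fst w2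
  have w : k ∣ c + d := by
    rcases T.white' with w | w | w
    · exact absurd w w1
    · exact absurd w w2
    · exact w
  obtain ⟨c1, c2, ⟨c3, c4⟩, c5, c6⟩ := T.bounds
  -- The first two volumes add up to -h (c + d), which is at most 2k ≤ 2h; so `k` divides 1 or 2.
  have u1 : c + d < 0 := by nlinarith
  have u2 : -3 < c + d := by nlinarith
  have hk : k ≠ 1 := by
    rintro rfl
    exact w1 (one_dvd _)
  obtain e | e : c + d = -1 ∨ c + d = -2 := by omega
  · rw [e, Int.dvd_neg] at w
    have := Int.le_of_dvd (by norm_num) w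
    omega
  · rw [e, Int.dvd_neg] at w
    have := Int.le_of_dvd (by norm_num) w
    obtain rfl : k = 2 := by omega
    obtain rfl : h = 2 := by
      obtain rfl : d = -2 - c := by omega
      linarith
    obtain ⟨s, rfl⟩ : ∃ s, c = 2 * s := ⟨c / 2, by omega⟩
    refine T.isRep_of_shear s (-s) (a' := -1) (b' := 1) (c' := 0) (d' := -2) (by omega) (by omega)
      (by omega) (by omega) fun T => ?_
    have hq := T.clean
    exact (hq.false_of_witness 0 (-1) (-1) 1 1 1 5 (by decide)).elim

theorem isRep (T : IsTet a b h c d k v) : IsRep (normalForm a b h c d k) := by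
  rcases T.white with w | w | ⟨s, hs⟩
  · exact T.isRep_of_dvd_fst w
  · exact isRep_of_swap (T.swap.isRep_of_dvd_fst w)
  · exact T.isRep_of_shear 0 (-s) (a' := a) (b' := -a) (c' := c) (by ring) (by linarith) (by ring)
      rfl isRep_of_sum_zero

end IsTet

theorem IsClean.isRep_of_tetrahedron (hp : IsClean p v) (h1 : 0 < v 1) (h2 : 0 < v 2)
    (h13 : v 1 ≤ v 3) (h23 : v 2 ≤ v 3) (h34 : v 3 ≤ v 4) : IsRep p := by
  obtain ⟨a, b, h, c, d, k, hh, -, e⟩ := hp.exists_normalForm (by omega) (by omega)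
    (.inl (by omega))
  exact (IsTet.isRep ⟨hp.of_uequiv e, hh, h1, h2, h13, h23, h34⟩).of_uequiv e

end Config

/-! ### Case distinction by the signs of the dependence -/

namespace Config

variable {p q r : Config} {v : Fin 5 → ℤ} {a b h c d k : ℤ}

/-- With at least two positive coefficients, the signs of `v 1` and `v 2` determine the signature.
Each permutation τ moves the points to the places expected by the lemma for that signature. -/
theorem IsClean.dichotomy_of_sorted (hp : IsClean p v) (hv : Monotone v) (h3 : 0 < v 3) :
    HasWidthOne p ∨ IsRep p := by
  have h01 : v 0 ≤ v 1 := hv (by decide)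
  have h12 : v 1 ≤ v 2 := hv (by decide)
  have h23 : v 2 ≤ v 3 := hv (by decide)
  have h34 : v 3 ≤ v 4 := hv (by decide)
  have hs := hp.relSum
  have h0 : v 0 < 0 := by omega
  rcases lt_trichotomy (v 1) 0 with h1 | h1 | h1
  · rcases lt_trichotomy (v 2) 0 with h2 | h2 | h2
    · exact .inl (hp.hasWidthOne_of_bipyramid h0 h1 h2 h3 (by omega))
    · let τ : Equiv.Perm (Fin 5) := ⟨![3, 0, 1, 2, 4], ![1, 2, 3, 0, 4], by decide, by decide⟩
      exact .inl (HasWidthLE.of_comp ((hp.comp τ).hasWidthOne_of_parallelogram h3 h0 h1 h2 h34))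
    · let τ : Equiv.Perm (Fin 5) := ⟨![2, 3, 4, 0, 1], ![3, 4, 0, 1, 2], by decide, by decide⟩
      refine .inl (HasWidthLE.of_comp ((hp.neg.comp τ).hasWidthOne_of_bipyramid ?_ ?_ ?_ ?_ ?_))
      · exact neg_neg_of_pos h2
      · exact neg_neg_of_pos h3
      · exact neg_neg_of_pos (h3.trans_le h34)
      · exact neg_pos_of_neg h0
      · exact neg_pos_of_neg h1
  · rcases (h1 ▸ h12).eq_or_lt with h2 | h2
    · let τ : Equiv.Perm (Fin 5) := ⟨![0, 3, 1, 2, 4], ![0, 2, 3, 1, 4], by decide, by decide⟩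
      exact .inl (HasWidthLE.of_comp ((hp.comp τ).hasWidthOne_of_collinear h3 h1 h2.symm h34))
    · let τ : Equiv.Perm (Fin 5) := ⟨![0, 2, 3, 1, 4], ![0, 3, 1, 2, 4], by decide, by decide⟩
      exact ((hp.comp τ).hasWidthOne_or_isRep_of_pyramid h2 h3 h1 (h23.trans h34) h34).imp
        HasWidthLE.of_comp IsRep.of_comp
  · exact .inr (hp.isRep_of_tetrahedron h1 (h1.trans_le h12) (h12.trans h23) h23 h34)

/-- A clean configuration of five points has width one, or it is one of the nine
representatives. -/
theorem IsClean.dichotomy (hp : IsClean p v) (hv : v ≠ 0) : HasWidthOne p ∨ IsRep p := by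
  set σ := Tuple.sort v
  have hm : Monotone (v ∘ σ) := Tuple.monotone_sort v
  have hw : v ∘ σ ≠ 0 := fun h => hv <| by
    funext i; simpa using congrFun h (σ.symm i)
  have hc := hp.comp σ
  generalize v ∘ σ = w at *
  suffices HasWidthOne (p ∘ σ) ∨ IsRep (p ∘ σ) from this.imp HasWidthLE.of_comp IsRep.of_comp
  by_cases h3 : 0 < w 3
  · exact hc.dichotomy_of_sorted hm h3
  -- With two negative coefficients, negating and reversing gives a sorted dependence with two
  -- positive ones. If neither sign occurs twice, the dependence makes two points coincide.
  by_cases h1 : w 1 < 0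
  · have hr : Monotone ((-w) ∘ Fin.revPerm) := fun i j hij =>
      neg_le_neg (hm (Fin.rev_le_rev.2 hij))
    exact ((hc.neg.comp Fin.revPerm).dichotomy_of_sorted hr (neg_pos_of_neg h1)).imp
      HasWidthLE.of_comp IsRep.of_comp
  have h12 : w 1 ≤ w 2 := hm (by decide)
  have h23 : w 2 ≤ w 3 := hm (by decide)
  have h34 : w 3 ≤ w 4 := hm (by decide)
  have hs := hc.relSum
  have e1 : w 1 = 0 := by omega
  have e2 : w 2 = 0 := by omega
  have e3 : w 3 = 0 := by omega
  have e0 : w 0 = -w 4 := by omega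
  by_cases h4 : w 4 = 0
  · exact absurd (funext fun i => by fin_cases i <;> simp [e0, e1, e2, e3, h4]) hw
  · have : (p ∘ σ) 0 = (p ∘ σ) 4 := by
      funext j
      have := hc.rel j
      rw [e0, e1, e2, e3] at this
      apply mul_left_cancel₀ h4
      linarith
    exact absurd (hc.injective this) (by decide)

end Config

/-! ### From lattice polytopes to configurations and back -/

namespace Config

variable {p q : Config} {v : Fin 5 → ℤ} {P Q : LatticePolytope 3}

/-- The inclusion of `ℤ³` in `ℝ³`. -/
def castVec (z : Fin 3 → ℤ) : Fin 3 → ℝ := fun i => (z i : ℝ)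

theorem castVec_injective : Function.Injective castVec := fun x y h => by
  funext i
  exact Int.cast_injective (α := ℝ) (congrFun h i)

theorem castVec_mem_integerLattice (z : Fin 3 → ℤ) : castVec z ∈ integerLattice 3 := ⟨z, rfl⟩

theorem castVec_add (x y : Fin 3 → ℤ) : castVec (x + y) = castVec x + castVec y := by
  funext i; simp [castVec]

theorem castVec_mulVec (M : Matrix (Fin 3) (Fin 3) ℤ) (x : Fin 3 → ℤ) :
    castVec (M *ᵥ x) = (M.map (Int.cast : ℤ → ℝ)) *ᵥ castVec x := by
  funext i; simp [castVec, mulVec, dotProduct]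

/-- The points of `p` are the lattice points of `P`, and `P` is their convex hull. -/
structure Presents (p : Config) (P : LatticePolytope 3) : Prop where
  injective : Function.Injective p
  latticePoints : P.latticePoints = Set.range fun i => castVec (p i)
  carrier : P.carrier = convexHull ℝ (Set.range fun i => castVec (p i))

theorem exists_presents (hP : P.size = 5) : ∃ p, Presents p P := by
  have hc : Nat.card P.latticePoints = 5 := hP
  have : Finite P.latticePoints := Nat.finite_of_card_ne_zero (by omega)
  let e := (Finite.equivFinOfCardEq hc).symm
  have hz : ∀ i, ∃ z, castVec z = (e i : Fin 3 → ℝ) := fun i => (e i).2.2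
  choose p hp using hz
  have hr : P.latticePoints = Set.range fun i => castVec (p i) := by
    ext x
    constructor
    · intro hx
      exact ⟨e.symm ⟨x, hx⟩, by simp [hp]⟩
    · rintro ⟨i, rfl⟩
      simp only [hp]
      exact (e i).2
  refine ⟨p, fun i j h => e.injective (Subtype.ext ?_), hr, ?_⟩
  · rw [← hp, ← hp, h]
  -- The generating set lies among the lattice points of P, so these have the same hull.
  obtain ⟨S, -, hSl, hS⟩ := P.exists_eq_convexHull
  apply le_antisymm
  · rw [hS]
    apply convexHull_mono
    rw [← hr]
    exact fun x hx => ⟨hS ▸ subset_convexHull ℝ S hx, hSl hx⟩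
  · apply convexHull_min
    · rw [← hr]
      exact Set.inter_subset_left
    · rw [hS]
      exact convex_convexHull ℝ S

theorem Presents.mem_carrier (h : Presents p P) (i : Fin 5) : castVec (p i) ∈ P.carrier := by
  rw [h.carrier]
  exact subset_convexHull ℝ _ ⟨i, rfl⟩

theorem Presents.convex (h : Presents p P) : Convex ℝ P.carrier := by
  rw [h.carrier]
  exact convex_convexHull ℝ _

/-- The linear functional with integral coefficients `α`. -/
noncomputable def functional (α : Fin 3 → ℤ) : (Fin 3 → ℝ) →ₗ[ℝ] ℝ :=
  ∑ i, (α i : ℝ) • LinearMap.proj i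

theorem functional_castVec (α z : Fin 3 → ℤ) : functional α (castVec z) = (α ⬝ᵥ z : ℤ) := by
  simp [functional, castVec, dotProduct]

theorem functional_single (α : Fin 3 → ℤ) (i : Fin 3) :
    functional α (Pi.single i 1) = α i := by
  simp [functional, Pi.single_apply]

theorem Presents.isClean (h : Presents p P) : ∃ v, v ≠ 0 ∧ IsClean p v := by
  -- Three coordinate rows and a row of ones express the dependence; the zero row pads the matrix to
  -- a singular square one, which has an integral kernel vector.
  let A : Matrix (Fin 5) (Fin 5) ℤ := Matrix.of
    ![fun i => p i 0, fun i => p i 1, fun i => p i 2, fun _ => 1, fun _ => 0]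
  obtain ⟨v, hv, hA⟩ := exists_mulVec_eq_zero_iff.2 (det_eq_zero_of_row_eq_zero (A := A) 4
    fun j => by simp [A])
  refine ⟨v, hv, fun z n hn hs hz => ?_, h.injective, fun α δ hα => ?_, ?_, ?_⟩
  · have hs' : (0 : ℝ) < ∑ i, (n i : ℝ) := by exact_mod_cast hs
    have hz' : castVec z = ∑ i, ((n i : ℝ) / ∑ j, (n j : ℝ)) • castVec (p i) := by
      funext j
      have e : ((∑ i, n i : ℤ) : ℝ) * z j = ∑ i, (n i : ℝ) * p i j := by
        have := congrFun hz j
        simp only [Pi.smul_apply, Finset.sum_apply, smul_eq_mul] at this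
        exact_mod_cast this
      simp only [castVec, Finset.sum_apply, Pi.smul_apply, smul_eq_mul, div_mul_eq_mul_div,
        ← Finset.sum_div]
      rw [← e, eq_div_iff hs'.ne']
      push_cast
      ring
    have hmem : castVec z ∈ P.latticePoints := by
      refine ⟨?_, castVec_mem_integerLattice z⟩
      rw [hz']
      refine h.convex.sum_mem (fun i _ => ?_) ?_ fun i _ => h.mem_carrier i
      · have : (0 : ℝ) ≤ n i := by exact_mod_cast hn i
        positivity
      · rw [← Finset.sum_div, div_self hs'.ne']
    rw [h.latticePoints] at hmem
    obtain ⟨i, hi⟩ := hmem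
    exact ⟨i, castVec_injective hi⟩
  · obtain ⟨e, he, hmem⟩ := P.full_dimensional
    have hconst : ∀ x ∈ P.carrier, functional α x = δ := by
      intro x hx
      rw [h.carrier] at hx
      have hsub : convexHull ℝ (Set.range fun i => castVec (p i)) ⊆ functional α ⁻¹' {(δ : ℝ)} := by
        apply convexHull_min
        · rintro _ ⟨i, rfl⟩
          simp [functional_castVec, hα]
        · exact (convex_singleton _).linear_preimage _
      exact hsub hx
    have htop := he.vectorSpan_eq_top_of_card_eq_finrank_add_one (by simp)
    have hker : vectorSpan ℝ (Set.range e) ≤ LinearMap.ker (functional α) := by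
      rw [vectorSpan_def, Submodule.span_le]
      rintro _ ⟨_, ⟨i, rfl⟩, _, ⟨j, rfl⟩, rfl⟩
      simp [hconst _ (hmem i), hconst _ (hmem j)]
    rw [htop] at hker
    funext i
    have : functional α (Pi.single i 1) = 0 := hker Submodule.mem_top
    rw [functional_single] at this
    exact_mod_cast this
  · have := congrFun hA 3
    simpa [A, mulVec, dotProduct] using this
  · funext j
    fin_cases j
    · have := congrFun hA 0
      simpa [A, mulVec, dotProduct, mul_comm] using this
    · have := congrFun hA 1
      simpa [A, mulVec, dotProduct, mul_comm] using this
    · have := congrFun hA 2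
      simpa [A, mulVec, dotProduct, mul_comm] using this

theorem Presents.isCompact_image (h : Presents p P) (f : (Fin 3 → ℝ) →ᵃ[ℝ] ℝ) :
    IsCompact (f '' P.carrier) := by
  rw [h.carrier]
  exact ((Set.finite_range _).isCompact_convexHull ℝ).image f.continuous_of_finiteDimensional

theorem Presents.widthWith_nonneg (h : Presents p P) (f : (Fin 3 → ℝ) →ᵃ[ℝ] ℝ) :
    0 ≤ P.widthWith f :=
  sub_nonneg.2 (Real.sInf_le_sSup _ (h.isCompact_image f).bddBelow (h.isCompact_image f).bddAbove)

theorem Presents.sub_le_widthWith (h : Presents p P) (f : (Fin 3 → ℝ) →ᵃ[ℝ] ℝ) (i j : Fin 5) :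
    f (castVec (p i)) - f (castVec (p j)) ≤ P.widthWith f :=
  sub_le_sub (le_csSup (h.isCompact_image f).bddAbove ⟨_, h.mem_carrier i, rfl⟩)
    (csInf_le (h.isCompact_image f).bddBelow ⟨_, h.mem_carrier j, rfl⟩)

theorem isIntegral_functional (α : Fin 3 → ℤ) :
    LatticePolytope.IsIntegral (functional α).toAffineMap := by
  rintro _ ⟨z, rfl⟩
  exact ⟨_, functional_castVec α z⟩

theorem functional_not_const {α : Fin 3 → ℤ} (hα : α ≠ 0) :
    ¬ ∃ c : ℝ, ∀ x, (functional α).toAffineMap x = c := by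
  rintro ⟨c, hc⟩
  apply hα
  funext i
  have h0 := hc 0
  have h1 := hc (Pi.single i 1)
  simp only [LinearMap.coe_toAffineMap, map_zero, functional_single] at h0 h1
  rw [← h0] at h1
  exact_mod_cast h1

theorem Presents.width_le (h : Presents p P) {n : ℤ} (hw : HasWidthLE n p) : P.width ≤ n := by
  obtain ⟨α, hα, m, hm⟩ := hw
  have hle : P.widthWith (functional α).toAffineMap ≤ n := by
    have hsub : (functional α).toAffineMap '' P.carrier ⊆ Set.Icc (m : ℝ) (m + n) := by
      rw [h.carrier, Set.image_subset_iff]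
      apply convexHull_min
      · rintro _ ⟨i, rfl⟩
        simp only [Set.mem_preimage, LinearMap.coe_toAffineMap, functional_castVec]
        exact ⟨by exact_mod_cast (hm i).1, by exact_mod_cast (hm i).2⟩
      · exact (convex_Icc _ _).affine_preimage _
    have hne : ((functional α).toAffineMap '' P.carrier).Nonempty := ⟨_, _, h.mem_carrier 0, rfl⟩
    have h1 := csSup_le hne fun x hx => (hsub hx).2
    have h2 := le_csInf hne fun x hx => (hsub hx).1
    unfold LatticePolytope.widthWith
    linarith
  have hb : BddBelow {w : ℝ | ∃ f : (Fin 3 → ℝ) →ᵃ[ℝ] ℝ,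
      LatticePolytope.IsIntegral f ∧ (¬ ∃ c : ℝ, ∀ x, f x = c) ∧ w = P.widthWith f} := by
    refine ⟨0, ?_⟩
    rintro _ ⟨f, -, -, rfl⟩
    exact h.widthWith_nonneg f
  exact (csInf_le hb ⟨_, isIntegral_functional α, functional_not_const hα, rfl⟩).trans hle

theorem exists_functional {f : (Fin 3 → ℝ) →ᵃ[ℝ] ℝ} (hf : LatticePolytope.IsIntegral f)
    (hc : ¬ ∃ c : ℝ, ∀ x, f x = c) :
    ∃ α : Fin 3 → ℤ, α ≠ 0 ∧ ∀ x y, f x - f y = functional α x - functional α y := by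
  have hα : ∀ i, ∃ n : ℤ, f.linear (Pi.single i 1) = n := by
    intro i
    obtain ⟨n, hn⟩ := hf _ (castVec_mem_integerLattice (Pi.single i 1))
    obtain ⟨m, hm⟩ := hf _ (castVec_mem_integerLattice 0)
    refine ⟨n - m, ?_⟩
    have e1 : castVec (Pi.single i 1) = Pi.single i 1 := by
      funext j; by_cases hij : j = i <;> simp [castVec, hij]
    have e0 : castVec 0 = 0 := by funext j; simp [castVec]
    rw [e1] at hn
    rw [e0] at hm
    have := f.linearMap_vsub (Pi.single i 1) 0
    simp only [vsub_eq_sub, sub_zero] at this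
    rw [this, hn, hm]
    push_cast
    rfl
  choose α hα using hα
  have hlin : f.linear = functional α := by
    apply LinearMap.pi_ext'
    intro i
    ext
    simp [hα, functional_single]
  have hsub : ∀ x y, f x - f y = functional α x - functional α y := by
    intro x y
    have := f.linearMap_vsub x y
    simp only [vsub_eq_sub] at this
    rw [← this, hlin, map_sub]
  refine ⟨α, fun h0 => hc ⟨f 0, fun x => ?_⟩, hsub⟩
  have := hsub x 0
  rw [h0] at this
  simp [functional] at this
  linarith

/-- Integral functionals differ by integers on lattice points, so a difference exceeding 1 is at
least 2. -/
theorem Presents.le_width (h : Presents p P) (hw : ¬ HasWidthOne p) : 2 ≤ P.width := by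
  refine le_csInf ⟨_, _, isIntegral_functional (Pi.single 0 1), functional_not_const
    (by simp), rfl⟩ ?_
  rintro _ ⟨f, hf, hc, rfl⟩
  obtain ⟨α, hα, hsub⟩ := exists_functional hf hc
  obtain ⟨j, hj⟩ := Finite.exists_min fun i => α ⬝ᵥ p i
  obtain ⟨i, hi⟩ : ∃ i, α ⬝ᵥ p j + 1 < α ⬝ᵥ p i := by
    by_contra hcon
    push Not at hcon
    exact hw ⟨α, hα, _, fun i => ⟨hj i, hcon i⟩⟩
  refine le_trans ?_ (h.sub_le_widthWith f i j)
  rw [hsub, functional_castVec, functional_castVec]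
  have : 2 ≤ α ⬝ᵥ p i - α ⬝ᵥ p j := by omega
  exact_mod_cast this

theorem Presents.size (h : Presents p P) : P.size = 5 := by
  unfold LatticePolytope.size
  have := Set.ncard_range_of_injective (castVec_injective.comp h.injective)
  rw [h.latticePoints]
  simpa [Function.comp_def] using this

theorem Presents.unimodularEquiv (h : Presents p P) (h' : Presents q Q) {σ : Equiv.Perm (Fin 5)}
    (e : UEquiv p (q ∘ σ)) : P.UnimodularEquiv Q := by
  obtain ⟨M, t, hM, e⟩ := e
  have hMi : M * M⁻¹ = 1 := mul_nonsing_inv _ hM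
  have hMi' : M⁻¹ * M = 1 := nonsing_inv_mul _ hM
  have map_mul : ∀ A B : Matrix (Fin 3) (Fin 3) ℤ, A * B = 1 →
      A.map (Int.cast : ℤ → ℝ) * B.map (Int.cast : ℤ → ℝ) = 1 := fun A B hAB => by
    have := congrArg (Int.castRingHom ℝ).mapMatrix hAB
    rw [_root_.map_mul, map_one] at this
    exact this
  let L : (Fin 3 → ℝ) ≃ₗ[ℝ] (Fin 3 → ℝ) := Matrix.toLin'OfInv (map_mul _ _ hMi') (map_mul _ _ hMi)
  let T : (Fin 3 → ℝ) ≃ᵃ[ℝ] (Fin 3 → ℝ) :=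
    L.toAffineEquiv.trans (AffineEquiv.constVAdd ℝ _ (castVec t))
  have hT : ∀ z, T (castVec z) = castVec (M *ᵥ z + t) := fun z => by
    rw [castVec_add, castVec_mulVec, add_comm]
    rfl
  refine ⟨T, ?_, ?_⟩
  · ext x
    constructor
    · rintro ⟨_, ⟨z, rfl⟩, rfl⟩
      exact ⟨_, (hT z).symm⟩
    · rintro ⟨z, rfl⟩
      refine ⟨castVec (M⁻¹ *ᵥ (z - t)), castVec_mem_integerLattice _, ?_⟩
      rw [hT, mulVec_mulVec, hMi, one_mulVec, sub_add_cancel]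
      rfl
  · have := AffineMap.image_convexHull T.toAffineMap (Set.range fun i => castVec (p i))
    rw [h.carrier, h'.carrier]
    refine this.trans ?_
    congr 1
    rw [← Set.range_comp, ← EquivLike.range_comp (fun i => castVec (q i)) σ]
    congr 1
    funext i
    exact (hT (p i)).trans (congrArg castVec (e i).symm)

theorem Presents.exists_uequiv (h : Presents p P) (h' : Presents q Q) (e : P.UnimodularEquiv Q) :
    ∃ σ : Equiv.Perm (Fin 5), UEquiv p (q ∘ σ) := by
  obtain ⟨T, hT, hTP⟩ := e
  have int : ∀ T : (Fin 3 → ℝ) ≃ᵃ[ℝ] (Fin 3 → ℝ), T '' integerLattice 3 = integerLattice 3 →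
      ∃ (M : Matrix (Fin 3) (Fin 3) ℤ) (t : Fin 3 → ℤ),
        ∀ z, T (castVec z) = castVec (M *ᵥ z + t) := by
    intro T hT
    have hz : ∀ z, ∃ w, castVec w = T (castVec z) := fun z => by
      have : T (castVec z) ∈ T '' integerLattice 3 := ⟨_, castVec_mem_integerLattice z, rfl⟩
      rw [hT] at this
      exact this
    choose g hg using hz
    -- The columns are T(eⱼ) - T(0). Applied to `T` and its inverse, this gives integral matrices
    -- inverse to each other, hence a unit determinant.
    refine ⟨Matrix.of fun i j => g (Pi.single j 1) i - g 0 i, g 0, fun z => ?_⟩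
    have e0 : castVec 0 = 0 := by funext j; simp [castVec]
    have key : ∀ z, T (castVec z) = T.linear (castVec z) + castVec (g 0) := fun z => by
      have := T.map_vadd 0 (castVec z)
      simp only [vadd_eq_add, add_zero] at this
      rw [this, hg, e0]
    have hs : castVec z = ∑ j, (z j : ℝ) • castVec (Pi.single j 1) := by
      funext i
      simp [castVec, Pi.single_apply]
    have hl : ∀ j, T.linear (castVec (Pi.single j 1)) =
        castVec (g (Pi.single j 1)) - castVec (g 0) := fun j => by
      rw [hg (Pi.single j 1), key, add_sub_cancel_right]
    rw [key, hs, map_sum]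
    funext i
    simp [hl, castVec, mulVec, dotProduct]
    exact Finset.sum_congr rfl fun j _ => mul_comm _ _
  obtain ⟨M, t, hM⟩ := int T hT
  obtain ⟨N, s, hN⟩ := int T.symm (by
    nth_rewrite 1 [← hT]
    rw [Set.image_image]
    simp)
  have hu : IsUnit M.det := by
    have hz : ∀ z, M *ᵥ (N *ᵥ z + s) + t = z := fun z => castVec_injective (by
      rw [← hM, ← hN]; simp)
    have h0 := hz 0
    rw [mulVec_zero, zero_add] at h0
    have h1 : ∀ z, (M * N) *ᵥ z = z := fun z => by
      have := hz z
      rw [mulVec_add, mulVec_mulVec, add_assoc, h0, add_zero] at this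
      exact this
    have h2 : M * N = 1 := Matrix.toLin'.injective (LinearMap.ext fun z => by
      simp only [toLin'_apply, h1, one_mulVec])
    exact isUnit_det_of_right_inverse h2
  have hi : ∀ i, ∃ j, q j = M *ᵥ p i + t := fun i => by
    have : T (castVec (p i)) ∈ Q.latticePoints :=
      ⟨hTP ▸ ⟨_, h.mem_carrier i, rfl⟩, hT ▸ ⟨_, castVec_mem_integerLattice _, rfl⟩⟩
    rw [h'.latticePoints, hM] at this
    obtain ⟨j, hj⟩ := this
    exact ⟨j, castVec_injective hj⟩
  choose f hf using hi
  have finj : Function.Injective f := fun i j hij => by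
    have : T (castVec (p i)) = T (castVec (p j)) := by rw [hM, hM, ← hf, ← hf, hij]
    exact h.injective (castVec_injective (T.injective this))
  exact ⟨Equiv.ofBijective f (Finite.injective_iff_bijective.1 finj), M, t, hu, hf⟩

end Config

namespace Config

variable {p q : Config} {v : Fin 5 → ℤ} {P Q : LatticePolytope 3} {a b h c d k : ℤ}

/-! ### The representatives as lattice polytopes -/

/-- The affine dependence of the points of `normalForm a b h c d k`. -/
def dependence (a b h c d k : ℤ) : Fin 5 → ℤ :=
  ![(k * a + h * c) + (k * b + h * d) - k - h, -(k * a + h * c), -(k * b + h * d), k, h]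

/-- For h ≠ 0 the first four points are affinely independent, so `u 4` determines all coefficients.
-/
theorem dependence_unique (hh : 0 < h) {u : Fin 5 → ℝ} (hu : u ≠ 0) (hs : ∑ i, u i = 0)
    (hr : ∑ i, u i • castVec (normalForm a b h c d k i) = 0) :
    ∃ t : ℝ, t ≠ 0 ∧ ∀ i, u i = t * dependence a b h c d k i := by
  have hx := congrFun hr 0
  have hy := congrFun hr 1
  have hz := congrFun hr 2
  simp [Fin.sum_univ_five, normalForm, castVec] at hx hy hz hs
  have hh' : (0 : ℝ) < h := by exact_mod_cast hh
  have e3 : u 3 = u 4 / h * k := by field_simp; linarith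
  have e4 : u 4 = u 4 / h * h := by field_simp
  have e1 : u 1 = u 4 / h * -(k * a + h * c) := by
    rw [e3] at hx
    rw [eq_neg_of_add_eq_zero_left ((add_assoc _ _ _).symm.trans hx)]
    field_simp
  have e2 : u 2 = u 4 / h * -(k * b + h * d) := by
    rw [e3] at hy
    rw [eq_neg_of_add_eq_zero_left ((add_assoc _ _ _).symm.trans hy)]
    field_simp
  have e0 : u 0 = u 4 / h * ((k * a + h * c) + (k * b + h * d) - k - h) := by
    linear_combination hs - e1 - e2 - e3 - e4
  have key : ∀ i, u i = u 4 / h * dependence a b h c d k i := by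
    intro i
    fin_cases i
    · simpa [dependence] using e0
    · simpa [dependence] using e1
    · simpa [dependence] using e2
    · simpa [dependence] using e3
    · simpa [dependence] using e4
  refine ⟨u 4 / h, fun h0 => hu (funext fun i => ?_), key⟩
  rw [key, h0, zero_mul, Pi.zero_apply]

theorem affineIndependent_normalForm (a b c d k : ℤ) (hh : 0 < h) :
    AffineIndependent ℝ fun i : Fin 4 => castVec (normalForm a b h c d k i.castSucc) := by
  rw [affineIndependent_iff_of_fintype]
  intro w hw hs
  rw [Finset.univ.weightedVSub_eq_linear_combination hw] at hs
  have hx := congrFun hs 0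
  have hy := congrFun hs 1
  have hz := congrFun hs 2
  simp [Fin.sum_univ_four, normalForm, castVec] at hx hy hz hw
  have e3 : w 3 = 0 := hz.resolve_right hh.ne'
  rw [e3] at hx hy hw
  simp at hx hy hw
  intro i
  fin_cases i <;> simp [hx, hy, e3]
  simpa [hx, hy] using hw

theorem reps_data (j : Fin 9) : ∃ a b h c d k, 0 < h ∧ reps j = normalForm a b h c d k ∧
    (Finset.univ.filter fun i => 0 < dependence a b h c d k i).card = (if j = 8 then 3 else 4) ∧
    (Finset.univ.filter fun i => dependence a b h c d k i < 0).card = 1 := by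
  fin_cases j
  · exact ⟨0, 0, 1, -1, -1, 1, by decide, rfl, by decide, by decide⟩
  · exact ⟨1, 1, 2, -1, -1, 1, by decide, rfl, by decide, by decide⟩
  · exact ⟨1, 1, 3, -1, -1, 2, by decide, rfl, by decide, by decide⟩
  · exact ⟨1, 3, 5, -1, -2, 3, by decide, rfl, by decide, by decide⟩
  · exact ⟨1, 3, 5, -1, -3, 4, by decide, rfl, by decide, by decide⟩
  · exact ⟨1, 5, 7, -1, -4, 5, by decide, rfl, by decide, by decide⟩
  · exact ⟨2, 5, 7, -2, -4, 5, by decide, rfl, by decide, by decide⟩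
  · exact ⟨1, 2, 5, -2, -3, 5, by decide, rfl, by decide, by decide⟩
  · exact ⟨1, 2, 3, -1, -1, 0, by decide, rfl, by decide, by decide⟩

/-- The convex hull of a representative. -/
noncomputable def repPolytope (j : Fin 9) : LatticePolytope 3 where
  carrier := convexHull ℝ (Set.range fun i => castVec (reps j i))
  exists_eq_convexHull := ⟨_, Set.finite_range _, by
    rintro _ ⟨i, rfl⟩
    exact castVec_mem_integerLattice _, rfl⟩
  full_dimensional := by
    obtain ⟨a, b, h, c, d, k, hh, e, -⟩ := reps_data j
    refine ⟨_, affineIndependent_normalForm a b c d k hh, fun i => ?_⟩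
    rw [e]
    exact subset_convexHull ℝ _ ⟨_, rfl⟩

/-- The coefficients of the four facet inequalities of the representatives. -/
def facets : Fin 9 → Fin 4 → Fin 4 → ℤ :=
  ![![![3, -1, -1, 1], ![-1, 3, -1, 1], ![-1, -1, 3, 1], ![-1, -1, -1, 1]],
    ![![4, -1, -2, 1], ![-1, 4, -2, 1], ![-1, -1, 3, 1], ![-2, -2, 1, 2]],
    ![![6, -1, -2, 1], ![-1, 6, -2, 1], ![-2, -2, 3, 2], ![-3, -3, 1, 3]],
    ![![9, -2, -1, 2], ![-1, 10, -6, 1], ![-3, -3, 4, 3], ![-5, -5, 3, 5]],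
    ![![12, -1, -2, 1], ![-3, 10, -6, 3], ![-4, -4, 5, 4], ![-5, -5, 3, 5]],
    ![![15, -2, -1, 2], ![-3, 14, -10, 3], ![-5, -5, 6, 5], ![-7, -7, 5, 7]],
    ![![15, -4, -2, 4], ![-3, 16, -11, 3], ![-5, -5, 7, 5], ![-7, -7, 6, 7]],
    ![![15, -5, -2, 5], ![-5, 15, -6, 5], ![-5, -5, 6, 5], ![-5, -5, 2, 5]],
    ![![6, -3, -1, 3], ![-3, 6, -4, 3], ![0, 0, 1, 0], ![-3, -3, 2, 3]]]

theorem nonneg_of_mem_convexHull {p : Config} {z : Fin 3 → ℤ}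
    (hz : castVec z ∈ convexHull ℝ (Set.range fun i => castVec (p i))) (α : Fin 3 → ℤ) (δ : ℤ)
    (H : ∀ i, 0 ≤ α ⬝ᵥ p i + δ) : 0 ≤ α ⬝ᵥ z + δ := by
  have hsub : convexHull ℝ (Set.range fun i => castVec (p i)) ⊆
      functional α ⁻¹' Set.Ici (-δ : ℝ) := by
    apply convexHull_min
    · rintro _ ⟨i, rfl⟩
      have : -δ ≤ α ⬝ᵥ p i := by linarith [H i]
      simp only [Set.mem_preimage, functional_castVec, Set.mem_Ici]
      exact_mod_cast this
    · exact (convex_Ici _).linear_preimage _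
  have := hsub hz
  simp only [Set.mem_preimage, functional_castVec, Set.mem_Ici] at this
  have : -δ ≤ α ⬝ᵥ z := by exact_mod_cast this
  linarith

theorem facets_nonneg : ∀ j i l, 0 ≤ facets j i 0 * reps j l 0 + facets j i 1 * reps j l 1 +
    facets j i 2 * reps j l 2 + facets j i 3 := by
  decide

theorem reps_box : ∀ j l, (-2 ≤ reps j l 0 ∧ reps j l 0 ≤ 2) ∧ (-4 ≤ reps j l 1 ∧ reps j l 1 ≤ 5) ∧
    (-5 ≤ reps j l 2 ∧ reps j l 2 ≤ 7) := by
  decide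

/-- The box contains every representative, so this finite search finds all lattice points of their
hulls. -/
theorem mem_reps_of_facets : ∀ (j : Fin 9), ∀ x ∈ Finset.Icc (-2 : ℤ) 2,
    ∀ y ∈ Finset.Icc (-4 : ℤ) 5, ∀ z ∈ Finset.Icc (-5 : ℤ) 7,
    (∀ i, 0 ≤ facets j i 0 * x + facets j i 1 * y + facets j i 2 * z + facets j i 3) →
    ∃ l, reps j l 0 = x ∧ reps j l 1 = y ∧ reps j l 2 = z := by
  decide +kernel

theorem reps_injective : ∀ j, Function.Injective (reps j) := by
  decide

theorem presents_repPolytope (j : Fin 9) : Presents (reps j) (repPolytope j) where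
  injective := reps_injective j
  carrier := rfl
  latticePoints := by
    ext x
    constructor
    · rintro ⟨hx, z, rfl⟩
      have key : ∀ (α : Fin 3 → ℤ) (δ : ℤ), (∀ i, 0 ≤ α 0 * reps j i 0 + α 1 * reps j i 1 +
          α 2 * reps j i 2 + δ) → 0 ≤ α 0 * z 0 + α 1 * z 1 + α 2 * z 2 + δ := by
        intro α δ H
        have := nonneg_of_mem_convexHull hx α δ (by simpa [dotProduct, Fin.sum_univ_three] using H)
        simpa [dotProduct, Fin.sum_univ_three] using this
      have hb := reps_box j
      have x0 := key ![1, 0, 0] 2 fun i => by simpa using by linarith [(hb i).1.1]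
      have x1 := key ![-1, 0, 0] 2 fun i => by simpa using by linarith [(hb i).1.2]
      have y0 := key ![0, 1, 0] 4 fun i => by simpa using by linarith [(hb i).2.1.1]
      have y1 := key ![0, -1, 0] 5 fun i => by simpa using by linarith [(hb i).2.1.2]
      have z0 := key ![0, 0, 1] 5 fun i => by simpa using by linarith [(hb i).2.2.1]
      have z1 := key ![0, 0, -1] 7 fun i => by simpa using by linarith [(hb i).2.2.2]
      simp at x0 x1 y0 y1 z0 z1
      obtain ⟨l, h0, h1, h2⟩ := mem_reps_of_facets j (z 0) (Finset.mem_Icc.2 (by omega)) (z 1)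
        (Finset.mem_Icc.2 (by omega)) (z 2) (Finset.mem_Icc.2 (by omega)) fun i =>
        key ![facets j i 0, facets j i 1, facets j i 2] (facets j i 3)
          fun l => by simpa using facets_nonneg j i l
      refine ⟨l, ?_⟩
      have : reps j l = z := by
        funext r
        fin_cases r
        exacts [h0, h1, h2]
      simp only [this]
      rfl
    · rintro ⟨i, rfl⟩
      exact ⟨subset_convexHull ℝ _ ⟨i, rfl⟩, castVec_mem_integerLattice _⟩

theorem reps_hasWidthLE_two (j : Fin 9) : HasWidthLE 2 (reps j) := by
  let α : Fin 9 → Fin 3 → ℤ := ![![1, 0, 0], ![1, 0, 0], ![1, 0, 0], ![1, 0, 0], ![1, 0, 0],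
    ![1, 0, 0], ![1, 1, -1], ![1, -1, 0], ![1, 0, 0]]
  have h : ∀ j, α j ≠ 0 ∧ ∀ i, -1 ≤ α j ⬝ᵥ reps j i ∧ α j ⬝ᵥ reps j i ≤ -1 + 2 := by decide
  exact ⟨α j, (h j).1, -1, (h j).2⟩

theorem reps_not_hasWidthOne (j : Fin 9) : ¬ HasWidthOne (reps j) := by
  rintro ⟨α, hα, m, hm⟩
  apply hα
  have h0 := hm 0
  have h1 := hm 1
  have h2 := hm 2
  have h3 := hm 3
  have h4 := hm 4
  clear hm hα
  have key : α 0 = 0 ∧ α 1 = 0 ∧ α 2 = 0 := by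
    fin_cases j <;>
      -- For a fixed representative this is integer linear arithmetic in the coefficients of α and
      -- `m`.
      simp [reps, normalForm, dotProduct, Fin.sum_univ_three] at h0 h1 h2 h3 h4 <;> omega
  funext r
  fin_cases r
  exacts [key.1, key.2.1, key.2.2]

theorem width_repPolytope (j : Fin 9) : (repPolytope j).width = 2 :=
  le_antisymm (by exact_mod_cast (presents_repPolytope j).width_le (reps_hasWidthLE_two j))
    ((presents_repPolytope j).le_width (reps_not_hasWidthOne j))

/-! ### The representatives are pairwise inequivalent -/

/-- The normalized signed volume of the simplex on four points of the configuration. -/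
def signedVolume (p : Config) (i₀ i₁ i₂ i₃ : Fin 5) : ℤ :=
  (Matrix.of ![p i₁ - p i₀, p i₂ - p i₀, p i₃ - p i₀]).det

theorem UEquiv.abs_signedVolume (e : UEquiv p q) (i₀ i₁ i₂ i₃ : Fin 5) :
    |signedVolume q i₀ i₁ i₂ i₃| = |signedVolume p i₀ i₁ i₂ i₃| := by
  obtain ⟨M, t, hM, e⟩ := e
  have : Matrix.of ![q i₁ - q i₀, q i₂ - q i₀, q i₃ - q i₀] =
      Matrix.of ![p i₁ - p i₀, p i₂ - p i₀, p i₃ - p i₀] * Mᵀ := by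
    ext i j
    fin_cases i <;>
      simp [e, Matrix.mul_apply, mulVec, dotProduct, Fin.sum_univ_three] <;> ring
  unfold signedVolume
  rw [this, det_mul, det_transpose, abs_mul, Int.isUnit_iff_abs_eq.1 hM, mul_one]

/-- The normalized volumes of the representatives. -/
def repVolume : Fin 9 → ℤ := ![4, 5, 7, 11, 13, 17, 19, 20, 9]

theorem repVolume_injective : Function.Injective repVolume := by
  decide

theorem signedVolume_eq (p : Config) (i₀ i₁ i₂ i₃ : Fin 5) : signedVolume p i₀ i₁ i₂ i₃ =
    (p i₁ 0 - p i₀ 0) * ((p i₂ 1 - p i₀ 1) * (p i₃ 2 - p i₀ 2) -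
      (p i₂ 2 - p i₀ 2) * (p i₃ 1 - p i₀ 1)) -
    (p i₁ 1 - p i₀ 1) * ((p i₂ 0 - p i₀ 0) * (p i₃ 2 - p i₀ 2) -
      (p i₂ 2 - p i₀ 2) * (p i₃ 0 - p i₀ 0)) +
    (p i₁ 2 - p i₀ 2) * ((p i₂ 0 - p i₀ 0) * (p i₃ 1 - p i₀ 1) -
      (p i₂ 1 - p i₀ 1) * (p i₃ 0 - p i₀ 0)) := by
  simp [signedVolume, det_fin_three]
  ring

theorem abs_signedVolume_reps (j : Fin 9) : |signedVolume (reps j) 1 2 3 4| = repVolume j := by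
  rw [signedVolume_eq]
  revert j
  decide

theorem abs_signedVolume_reps_le (j : Fin 9) (i₀ i₁ i₂ i₃ : Fin 5) :
    |signedVolume (reps j) i₀ i₁ i₂ i₃| ≤ repVolume j := by
  rw [signedVolume_eq]
  revert j i₀ i₁ i₂ i₃
  decide +kernel

/-- The largest volume of a simplex on four lattice points is invariant, and it is `repVolume j` for
each representative, attained by omitting the origin. -/
theorem repPolytope_inequivalent {i j : Fin 9}
    (h : (repPolytope i).UnimodularEquiv (repPolytope j)) : i = j := by
  have key : ∀ i j, (repPolytope i).UnimodularEquiv (repPolytope j) →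
      repVolume i ≤ repVolume j := by
    intro i j h
    obtain ⟨σ, e⟩ := (presents_repPolytope i).exists_uequiv (presents_repPolytope j) h
    rw [← abs_signedVolume_reps, ← e.abs_signedVolume]
    exact abs_signedVolume_reps_le j (σ 1) (σ 2) (σ 3) (σ 4)
  exact repVolume_injective (le_antisymm (key _ _ h) (key _ _ h.symm))

/-! ### Signatures -/

theorem hasSignature_of_unimodularEquiv (h : P.UnimodularEquiv Q) {i j : ℕ}
    (hP : P.HasSignature i j) : Q.HasSignature i j := by
  obtain ⟨T, hT, hTP⟩ := h
  obtain ⟨p, hp, hr, v, hv, hs, hz, hi, hj⟩ := hP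
  refine ⟨T ∘ p, T.injective.comp hp, ?_, v, hv, hs, ?_, hi, hj⟩
  · rw [Set.range_comp, hr, LatticePolytope.latticePoints, Set.image_inter T.injective, hT, hTP]
    rfl
  · have key : ∀ x, T x = T.linear x + T 0 := fun x => by
      have := T.map_vadd 0 x
      simpa using this
    simp only [Function.comp_apply]
    simp_rw [key (p _), smul_add, Finset.sum_add_distrib, ← Finset.sum_smul, hs, zero_smul,
      add_zero, ← map_smul, ← map_sum, hz, map_zero]

theorem ncard_setOf_comp (σ : Equiv.Perm (Fin 5)) (f : Fin 5 → Prop) :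
    {i | f (σ i)}.ncard = {i | f i}.ncard := by
  rw [← Set.ncard_image_of_injective _ σ.injective]
  congr 1
  ext i
  simp

/-- Any dependence is `t` times the standard one; a negative `t` exchanges the two counts. -/
theorem signature_of_presents (hh : 0 < h) (hP : Presents (normalForm a b h c d k) P) {i j : ℕ}
    (hs : P.HasSignature i j) :
    ({l | 0 < dependence a b h c d k l}.ncard = i ∧ {l | dependence a b h c d k l < 0}.ncard = j) ∨
    ({l | 0 < dependence a b h c d k l}.ncard = j ∧
      {l | dependence a b h c d k l < 0}.ncard = i) := by
  obtain ⟨p, hp, hr, v, hv, hs, hz, rfl, rfl⟩ := hs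
  have hf : ∀ l, ∃ m, castVec (normalForm a b h c d k m) = p l := fun l => by
    have : p l ∈ Set.range p := ⟨l, rfl⟩
    rwa [hr, hP.latticePoints] at this
  choose f hf using hf
  have finj : Function.Injective f := fun l m hlm => hp (by rw [← hf, ← hf, hlm])
  let σ := Equiv.ofBijective f (Finite.injective_iff_bijective.1 finj)
  obtain ⟨t, ht, hu⟩ := dependence_unique (a := a) (b := b) (c := c) (d := d) (k := k) hh
    (u := v ∘ σ.symm)
    (fun h0 => hv (funext fun l => by simpa using congrFun h0 (σ l)))
    (by rw [← hs]; exact Equiv.sum_comp σ.symm v)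
    (by
      rw [← hz, ← Equiv.sum_comp σ]
      refine Finset.sum_congr rfl fun l _ => ?_
      rw [← hf]
      simp [σ])
  have hv' : ∀ l, v l = t * dependence a b h c d k (σ l) := fun l => by
    simpa using hu (σ l)
  simp_rw [hv']
  rw [ncard_setOf_comp σ fun l => 0 < t * (dependence a b h c d k l : ℝ),
    ncard_setOf_comp σ fun l => t * (dependence a b h c d k l : ℝ) < 0]
  rcases ht.lt_or_gt with ht | ht
  · right
    have h1 : ∀ x : ℝ, t * x < 0 ↔ 0 < x := fun x => by
      constructor <;> intro hx <;> nlinarith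
    have h2 : ∀ x : ℝ, 0 < t * x ↔ x < 0 := fun x => by
      constructor <;> intro hx <;> nlinarith
    simp [h1, h2]
  · left
    simp [mul_neg_iff, ht, ht.not_gt]

theorem hasSignature_repPolytope_iff (j : Fin 9) (m : ℕ) (hm : 1 < m) :
    (repPolytope j).HasSignature m 1 ↔ m = if j = 8 then 3 else 4 := by
  have hP := presents_repPolytope j
  obtain ⟨a, b, h, c, d, k, hh, e, e1, e2⟩ := reps_data j
  rw [e] at hP
  have c1 : {l | 0 < dependence a b h c d k l}.ncard = if j = 8 then 3 else 4 := by
    rw [Set.ncard_eq_toFinset_card', ← e1]; congr 1; ext; simp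
  have c2 : {l | dependence a b h c d k l < 0}.ncard = 1 := by
    rw [Set.ncard_eq_toFinset_card', ← e2]; congr 1; ext; simp
  constructor
  · intro hs
    rcases signature_of_presents hh hP hs with ⟨h1, -⟩ | ⟨-, h2⟩
    · rw [← h1, c1]
    -- In the exchanged case the number of negative coefficients, which is 1, would equal `m`,
    -- against `hm`.
    · omega
  · rintro rfl
    refine ⟨fun i => castVec (normalForm a b h c d k i), castVec_injective.comp hP.injective,
      hP.latticePoints.symm, fun i => dependence a b h c d k i, ?_, ?_, ?_, ?_, ?_⟩
    · intro h0
      have := congrFun h0 4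
      simp [dependence] at this
      omega
    · simp [Fin.sum_univ_five, dependence]
      ring
    · funext r
      fin_cases r <;> (simp [Fin.sum_univ_five, dependence, normalForm, castVec]; try ring)
    · rw [← c1]; simp
    · rw [← c2]; simp

/-! ### The classification -/

/-- The equivalence class of a representative. -/
noncomputable def repClass (j : Fin 9) : LatticePolytope.EquivClass 3 :=
  LatticePolytope.toClass (repPolytope j)

theorem repClass_injective : Function.Injective repClass := fun _ _ h =>
  repPolytope_inequivalent (Quotient.exact h)

theorem width_le_one_or_equiv (hP : P.size = 5) :
    P.width ≤ 1 ∨ ∃ j, P.UnimodularEquiv (repPolytope j) := by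
  obtain ⟨p, hp⟩ := exists_presents hP
  obtain ⟨v, hv, hc⟩ := hp.isClean
  rcases hc.dichotomy hv with h | ⟨j, σ, e⟩
  · exact .inl (by exact_mod_cast hp.width_le h)
  · exact .inr ⟨j, hp.unimodularEquiv (presents_repPolytope j) e⟩

theorem exists_equiv_of_width_eq_two (hP : P.size = 5) (hw : P.width = 2) :
    ∃ j, P.UnimodularEquiv (repPolytope j) :=
  (width_le_one_or_equiv hP).resolve_left (by rw [hw]; norm_num)

theorem image_toClass_signature (m : ℕ) (hm : 1 < m) :
    LatticePolytope.toClass ''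
      {P : LatticePolytope 3 | P.size = 5 ∧ P.width = 2 ∧ P.HasSignature m 1} =
    repClass '' {j | m = if j = 8 then 3 else 4} := by
  ext x
  constructor
  · rintro ⟨P, ⟨hP, hw, hs⟩, rfl⟩
    obtain ⟨j, e⟩ := exists_equiv_of_width_eq_two hP hw
    exact ⟨j, (hasSignature_repPolytope_iff j m hm).1 (hasSignature_of_unimodularEquiv e hs),
      (Quotient.sound e).symm⟩
  · rintro ⟨j, hj, rfl⟩
    exact ⟨repPolytope j, ⟨(presents_repPolytope j).size, width_repPolytope j,
      (hasSignature_repPolytope_iff j m hm).2 hj⟩, rfl⟩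

theorem image_toClass : LatticePolytope.toClass ''
    {P : LatticePolytope 3 | P.size = 5 ∧ P.width = 2} = Set.range repClass := by
  ext x
  constructor
  · rintro ⟨P, ⟨hP, hw⟩, rfl⟩
    obtain ⟨j, e⟩ := exists_equiv_of_width_eq_two hP hw
    exact ⟨j, (Quotient.sound e).symm⟩
  · rintro ⟨j, rfl⟩
    exact ⟨repPolytope j, ⟨(presents_repPolytope j).size, width_repPolytope j⟩, rfl⟩

theorem width_le_two (hP : P.size = 5) : P.width ≤ 2 := by
  obtain ⟨p, hp⟩ := exists_presents hP
  obtain ⟨v, hv, hc⟩ := hp.isClean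
  rcases hc.dichotomy hv with h | ⟨j, σ, e⟩
  · linarith [show P.width ≤ 1 by exact_mod_cast hp.width_le h]
  · have h2 : HasWidthLE 2 ((reps j ∘ σ) ∘ σ.symm) := by
      rw [Function.comp_assoc]
      simpa using reps_hasWidthLE_two j
    exact_mod_cast hp.width_le (h2.of_comp.of_uequiv e)

end Config

/-- Up to unimodular equivalence there are exactly nine lattice `3`-polytopes of size five and
width two, and none of size five has larger width; eight of the nine have signature `(4, 1)` and
one has signature `(3, 1)`. -/
theorem mainTheorem2 :
    (LatticePolytope.toClass ''
      {P : LatticePolytope 3 | P.size = 5 ∧ P.width = 2}).ncard = 9 ∧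
    (∀ P : LatticePolytope 3, P.size = 5 → P.width ≤ 2) ∧
    (LatticePolytope.toClass ''
      {P : LatticePolytope 3 | P.size = 5 ∧ P.width = 2 ∧ P.HasSignature 4 1}).ncard = 8 ∧
    (LatticePolytope.toClass ''
      {P : LatticePolytope 3 | P.size = 5 ∧ P.width = 2 ∧ P.HasSignature 3 1}).ncard = 1 := by
  refine ⟨?_, fun P hP => Config.width_le_two hP, ?_, ?_⟩
  · rw [Config.image_toClass, Set.ncard_range_of_injective Config.repClass_injective]
    simp
  · rw [Config.image_toClass_signature 4 (by norm_num),
      Set.ncard_image_of_injective _ Config.repClass_injective, Set.ncard_eq_toFinset_card']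
    decide
  · rw [Config.image_toClass_signature 3 (by norm_num),
      Set.ncard_image_of_injective _ Config.repClass_injective, Set.ncard_eq_toFinset_card']
    decide
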